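/- Let $S$ be a Polish space, let $(\xi,N)$ be a random pair with $\xi$ in a measurable space and $N\in\{0,1,2,\dots,\infty\}$, and let $g$ be a measurable $S$-valued function of $\xi$ and of a finite or infinite sequence in $S$. For $n\le\infty$ write $1\le j\le^* n$ for $1\le j\le n$ if $n<\infty$ and for $1\le j<\infty$ if $n=\infty$. Let $\mathcal V=\{\emptyset\}\cup\bigcup_{d\ge1}\mathbb N^d$, with $|\mathbf i|$ the length of the word $\mathbf i$. For a probability measure $\mu$ on $S$, an invariant recursive tree process (RTP) with marginal $\mu$ is a family $(X_{\mathbf i})_{\mathbf i\in\mathcal V}$ of $S$-valued random variables, together with i.i.d. copies $(\xi_{\mathbf i},N_{\mathbf i})_{\mathbf i\in\mathcal V}$ of $(\xi,N)$ on the same probability space, such that (i) $X_{\mathbf i}\sim\mu$ for all $\mathbf i\in\mathcal V$; (ii) for each $d\ge0$ the variables $(X_{\mathbf i})_{|\mathbf i|=d}$ are independent; (iii) for all $\mathbf i\in\mathcal V$, $X_{\mathbf i}=g\bigl(\xi_{\mathbf i};(X_{\mathbf ij}:1\le j\le^*N_{\mathbf i})\bigr)$ almost surely; (iv) for each $d\ge0$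 the family $(X_{\mathbf i})_{|\mathbf i|=d}$ is independent of $\{(\xi_{\mathbf i},N_{\mathbf i}):|\mathbf i|<d\}$. Its tail is $\mathcal H=\bigcap_{n\ge0}\sigma(X_{\mathbf i}:|\mathbf i|\ge n)$, and the tail is trivial if every event in $\mathcal H$ has probability $0$ or $1$. For a probability measure $\lambda$ on $S^2$ let $(T\otimes T)(\lambda)$ be the law of $$\Bigl(g\bigl(\xi;(X^{(1)}_j:1\le j\le^*N)\bigr),\; g\bigl(\eta;(X^{(2)}_j:1\le j\le^*M)\bigr)\Bigr),$$ where the pairs $(X^{(1)}_j,X^{(2)}_j)_{j\ge1}$ are i.i.d. with law $\lambda$, and $(\eta,M)$ is an independent copy of $(\xi,N)$, with $(\xi,N),(\eta,M)$ independent of these pairs. The bivariate uniqueness property of the second kind says that $\mu\otimes\mu$ is the unique fixed point of $T\otimes T$ both of whose marginals are $\mu$. Let $\mu^{\nearrow}$ be the law of $(X,X)$ for $X\sim\mu$. Theorem. Consider an invariant RTP with marginal $\mu$. (a) If the tail of the RTP is trivial, then the bivariate uniqueness property of the second kind holds. (b) If the bivariate uniqueness property of the second kind holds, and $T\otimes T$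 is continuous with respect to weak convergence on the set of probability measures on $S^2$ with both marginals $\mu$, then the tail of the RTP is trivial. (c) The tail of the RTP is trivial if and only if $(T\otimes T)^n(\mu^{\nearrow})$ converges weakly to $\mu\otimes\mu$ as $n\to\infty$. -/

import Mathlib

open MeasureTheory ProbabilityTheory Filter Topology

namespace RecTree

/-- Sequences in `S` of length `n`, for all lengths `n ∈ {0, 1, 2, …, ∞}` together. Terms are
numbered from `0`, so the indices `1 ≤ j ≤* n` of the usual notation are here the `j : ℕ` with
`j < n`. The measurable structure is that of a disjoint union of product spaces. -/
abbrev Seqs (S : Type*) : Type _ :=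
  Σ n : ℕ∞, ({j : ℕ // (j : ℕ∞) < n} → S)

/-- The first `n` terms of the infinite sequence `x` (all of them if `n = ∞`). -/
def trunc {S : Type*} (n : ℕ∞) (x : ℕ → S) : Seqs S :=
  ⟨n, fun j => x j⟩

theorem measurable_trunc {S : Type*} [MeasurableSpace S] :
    Measurable (fun p : ℕ∞ × (ℕ → S) => trunc p.1 p.2) := by
  refine measurable_from_prod_countable_right fun n => ?_
  have h1 : Measurable (fun (x : ℕ → S) (j : {j : ℕ // (j : ℕ∞) < n}) => x j) :=
    measurable_pi_lambda _ fun j => measurable_pi_apply _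
  have h2 : Measurable
      (fun y : {j : ℕ // (j : ℕ∞) < n} → S => (⟨n, y⟩ : Seqs S)) :=
    fun s hs => MeasurableSpace.measurableSet_iInf.1 hs n
  exact h2.comp h1

/-- The data of a recursive distributional equation `X =ᵈ g (ξ; (X_j : 1 ≤ j ≤* N))` on `S`,
with `ξ` taking values in a measurable space `E`: the joint law of the innovation `(ξ, N)` and the
measurable function `g`. -/
structure RDE (E S : Type*) [MeasurableSpace E] [MeasurableSpace S] where
  /-- The joint law of the pair `(ξ, N)`. -/
  law : ProbabilityMeasure (E × ℕ∞)
  /-- The function on the right-hand side of the equation. -/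
  g : E → Seqs S → S
  measurable_g : Measurable (fun p : E × Seqs S => g p.1 p.2)

section

variable {E S : Type*} [MeasurableSpace E] [MeasurableSpace S]

/-- The random variable `g (ξ; (x_j : 1 ≤ j ≤* N))` as a function of `(ξ, N)` and of an infinite
sequence `x`, of which only the first `N` terms are used. -/
def RDE.apply (R : RDE E S) (e : E × ℕ∞) (x : ℕ → S) : S :=
  R.g e.1 (trunc e.2 x)

theorem RDE.measurable_apply (R : RDE E S) :
    Measurable (fun p : (E × ℕ∞) × (ℕ → S) => R.apply p.1 p.2) := by
  have h1 : Measurable (fun p : (E × ℕ∞) × (ℕ → S) => trunc p.1.2 p.2) :=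
    measurable_trunc.comp ((measurable_snd.comp measurable_fst).prodMk measurable_snd)
  exact R.measurable_g.comp ((measurable_fst.comp measurable_fst).prodMk h1)

/-- The pair `(g (ξ; (x⁽¹⁾_j : 1 ≤ j ≤* N)), g (η; (x⁽²⁾_j : 1 ≤ j ≤* M)))` as a function of
`(ξ, N)`, of `(η, M)` and of the sequence of pairs `(x⁽¹⁾_j, x⁽²⁾_j)`. -/
def RDE.applyPair (R : RDE E S) (p : ((E × ℕ∞) × (E × ℕ∞)) × (ℕ → S × S)) : S × S :=
  (R.apply p.1.1 (fun j => (p.2 j).1), R.apply p.1.2 (fun j => (p.2 j).2))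

theorem RDE.measurable_applyPair (R : RDE E S) : Measurable R.applyPair := by
  refine Measurable.prodMk ?_ ?_
  · refine R.measurable_apply.comp ((measurable_fst.comp measurable_fst).prodMk ?_)
    exact measurable_pi_lambda _ fun j =>
      measurable_fst.comp ((measurable_pi_apply j).comp measurable_snd)
  · refine R.measurable_apply.comp ((measurable_snd.comp measurable_fst).prodMk ?_)
    exact measurable_pi_lambda _ fun j =>
      measurable_snd.comp ((measurable_pi_apply j).comp measurable_snd)

/-- The joint law of the inputs of `T ⊗ T`: two independent innovation pairs and, independent of
them, a sequence of independent pairs with law `lam`. -/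
noncomputable def RDE.inputLaw (R : RDE E S) (lam : ProbabilityMeasure (S × S)) :
    ProbabilityMeasure (((E × ℕ∞) × (E × ℕ∞)) × (ℕ → S × S)) :=
  ⟨((R.law : Measure (E × ℕ∞)).prod (R.law : Measure (E × ℕ∞))).prod
    (Measure.infinitePi fun _ : ℕ => (lam : Measure (S × S))), inferInstance⟩

/-- The bivariate operator `T ⊗ T`, with independent innovations in the two coordinates. -/
noncomputable def RDE.biOp (R : RDE E S) (lam : ProbabilityMeasure (S × S)) :
    ProbabilityMeasure (S × S) :=
  (R.inputLaw lam).map R.measurable_applyPair.aemeasurable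

/-- The bivariate laws both of whose marginals are `μ`. -/
def withMarginals (μ : ProbabilityMeasure S) : Set (ProbabilityMeasure (S × S)) :=
  {lam | lam.map measurable_fst.aemeasurable = μ ∧ lam.map measurable_snd.aemeasurable = μ}

/-- The diagonal measure with marginal `μ`: the law of `(X, X)` for `X ∼ μ`. -/
noncomputable def diagonal (μ : ProbabilityMeasure S) : ProbabilityMeasure (S × S) :=
  μ.map (f := fun x => (x, x)) (measurable_id.prodMk measurable_id).aemeasurable

/-- The bivariate uniqueness property of the second kind: `μ ⊗ μ` is the unique fixed point of
`T ⊗ T` with marginals `μ`. -/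
def RDE.BivariateUniqueness (R : RDE E S) (μ : ProbabilityMeasure S) : Prop :=
  {lam | lam ∈ withMarginals μ ∧ R.biOp lam = lam} = {μ.prod μ}

variable {Ω : Type*} [MeasurableSpace Ω]

/-- `X` is an invariant recursive tree process with marginal `μ` and innovation process
`(ξ_i, N_i) = innov i`. Vertices are finite words over `ℕ`, the root is the empty word, and the
children of `i` are the words `i ++ [j]`. -/
structure IsInvariantRTP (R : RDE E S) (μ : ProbabilityMeasure S) (P : Measure Ω)
    (innov : List ℕ → Ω → E × ℕ∞) (X : List ℕ → Ω → S) : Prop where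
  measurable_innov : ∀ i, Measurable (innov i)
  measurable_X : ∀ i, Measurable (X i)
  /-- The innovations are copies of `(ξ, N)`. -/
  innov_law : ∀ i, P.map (innov i) = (R.law : Measure (E × ℕ∞))
  /-- The innovations are independent. -/
  innov_indep : iIndepFun innov P
  /-- Every `X i` has law `μ`. -/
  X_law : ∀ i, P.map (X i) = (μ : Measure S)
  /-- The variables of one generation are independent. -/
  X_indep : ∀ d : ℕ, iIndepFun (fun i : {i : List ℕ // i.length = d} => X i) P
  /-- The recursion `X_i = g (ξ_i; (X_{ij} : 1 ≤ j ≤* N_i))` holds almost surely. -/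
  recursion : ∀ i, ∀ᵐ ω ∂P, X i ω = R.apply (innov i ω) (fun j => X (i ++ [j]) ω)
  /-- Generation `d` of the process is independent of the innovations of all earlier
  generations. -/
  X_indep_innov : ∀ d : ℕ,
    IndepFun (fun ω (i : {i : List ℕ // i.length = d}) => X i ω)
      (fun ω (i : {i : List ℕ // i.length < d}) => innov i ω) P

/-- The σ-algebra generated by the `X i` with `|i| ≥ n`. -/
abbrev sigmaFrom (X : List ℕ → Ω → S) (n : ℕ) : MeasurableSpace Ω :=
  ⨆ (i : List ℕ) (_ : n ≤ i.length), MeasurableSpace.comap (X i) inferInstance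

/-- The tail σ-algebra of `X`. -/
abbrev tailSigma (X : List ℕ → Ω → S) : MeasurableSpace Ω :=
  ⨅ n : ℕ, sigmaFrom X n

/-- Every event of the tail σ-algebra has probability `0` or `1`. -/
def TrivialTail (P : Measure Ω) (X : List ℕ → Ω → S) : Prop :=
  ∀ A : Set Ω, MeasurableSet[tailSigma X] A → P A = 0 ∨ P A = 1

end

end RecTree

/-! Unfolding the recursion `n` times expresses the root through the innovations of generations
below `n` and the boundary values in generation `n`. These innovations are independent of all `X i`
with `n ≤ |i|`, so averaging over them alone, as `RDE.condMean` does, gives the conditional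
expectation of `f (X [])` given `sigmaFrom X n` (`condExp_root_eq`). The `n`-th iterate of `T ⊗ T`
evaluates two such trees with independent innovations on coupled boundary values, so its integral of
`f ⊗ g` is the expectation of a product of two conditional means (`RDE.integral_biOp_iterate`).
Started from the diagonal, both trees see the same boundary, and `f = g` produces a second moment.

Everything passes through `RDE.IsMixing`. A trivial tail implies it by reverse martingale
convergence. Convergence of the diagonal iterates to `μ ⊗ μ` implies it because the variance of the
conditional mean then vanishes in the limit. Conversely, mixing at all vertices of a generation
makes that generation independent of the tail; adding the earlier innovations makes the whole
process, hence the tail itself, independent of the tail. Mixing also drives the iterates of every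
coupling of `μ` with itself to `μ ⊗ μ`, which excludes other fixed points.

For (b), the diagonal iterates always converge, namely to the law of two copies of the root that are
conditionally independent given the tail (`exists_tendsto_diagonal`). Continuity makes this limit a
fixed point, uniqueness identifies it, and (c) applies. -/

namespace RecTree

/-! ### Infinite product measures and independence. -/

section Products

theorem map_zip_infinitePi {ι α β : Type*} [MeasurableSpace α] [MeasurableSpace β]
    (ρ : Measure α) (τ : Measure β) [IsProbabilityMeasure ρ] [IsProbabilityMeasure τ] :
    ((Measure.infinitePi fun _ : ι => ρ).prod (Measure.infinitePi fun _ : ι => τ)).map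
      (fun p i => (p.1 i, p.2 i)) = Measure.infinitePi fun _ : ι => ρ.prod τ := by
  refine (Measure.isProjectiveLimit_infinitePi _).unique (fun I => ?_) |>.symm
  have h := (measurePreserving_arrowProdEquivProdArrow α β I (fun _ => ρ) (fun _ => τ)).symm
  rw [← h.map_eq, ← Measure.infinitePi_map_restrict (fun _ : ι => ρ),
    ← Measure.infinitePi_map_restrict (fun _ : ι => τ),
    Measure.map_prod_map _ _ (by fun_prop) (by fun_prop), Measure.map_map (by fun_prop)
    (by fun_prop), Measure.map_map (by fun_prop) (by fun_prop)]
  rfl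

theorem map_infinitePi_curry {ι κ γ α : Type*} [MeasurableSpace α] (ρ : Measure α)
    [IsProbabilityMeasure ρ] {φ : ι → κ → γ} (hφ : Function.Injective (fun p : ι × κ => φ p.1 p.2)) :
    (Measure.infinitePi fun _ : γ => ρ).map (fun w i j => w (φ i j)) =
      Measure.infinitePi fun _ : ι => Measure.infinitePi fun _ : κ => ρ := by
  have h := Measure.infinitePi_map_curry (fun (_ : ι) (_ : κ) => ρ)
  have h2 := Measure.map_infinitePi_infinitePi_of_inj (P := fun _ : γ => ρ) hφ
  rw [← h, ← h2, Measure.map_map (by fun_prop) (by fun_prop)]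
  rfl

theorem indepFun_pi_of_disjoint {Ω ι β : Type*} [MeasurableSpace Ω] [MeasurableSpace β]
    {P : Measure Ω} {f : ι → Ω → β} (hf : ∀ i, Measurable (f i)) (h : iIndepFun f P)
    {s t : Set ι} (hst : Disjoint s t) :
    IndepFun (fun ω (i : s) => f i ω) (fun ω (i : t) => f i ω) P := by
  have := indep_iSup_of_disjoint (fun i => (hf i).comap_le) h.iIndep hst
  rw [IndepFun_iff_Indep, MeasurableSpace.comap_process_pi, MeasurableSpace.comap_process_pi]
  simpa only [iSup_subtype] using this

/-- Both hypotheses together say that the law of the triple is a product of three; reassociating it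
regroups the variables. -/
theorem indepFun_prodMk_of_indepFun {Ω α β γ : Type*} [MeasurableSpace Ω] {mα : MeasurableSpace α}
    {mβ : MeasurableSpace β} {mγ : MeasurableSpace γ} {P : Measure Ω} [IsProbabilityMeasure P]
    {U : Ω → α} {V : Ω → β} {W : Ω → γ} (hU : Measurable U) (hV : Measurable V)
    (hW : Measurable W) (h1 : IndepFun U (fun ω => (V ω, W ω)) P) (h2 : IndepFun V W P) :
    IndepFun (fun ω => (U ω, V ω)) W P := by
  have h3 : IndepFun U V P := h1.comp measurable_id measurable_fst
  rw [indepFun_iff_map_prod_eq_prod_map_map (by fun_prop) (by fun_prop)] at h1 h2 h3 ⊢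
  have : IsProbabilityMeasure (P.map U) := Measure.isProbabilityMeasure_map hU.aemeasurable
  have : IsProbabilityMeasure (P.map V) := Measure.isProbabilityMeasure_map hV.aemeasurable
  have : IsProbabilityMeasure (P.map W) := Measure.isProbabilityMeasure_map hW.aemeasurable
  rw [h2, ← Measure.prodAssoc_prod, ← h3] at h1
  apply MeasurableEquiv.prodAssoc.map_measurableEquiv_injective
  rw [← h1, Measure.map_map (by fun_prop) (by fun_prop)]
  rfl

/-- Splits an i.i.d. field on the tree into the root and the subtrees at its children; this drives
the induction on the height. -/
theorem map_cons_infinitePi {α : Type*} [MeasurableSpace α] (ρ : Measure α)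
    [IsProbabilityMeasure ρ] :
    (Measure.infinitePi fun _ : List ℕ => ρ).map
      (fun w => (w [], fun (j : ℕ) (i : List ℕ) => w (j :: i))) =
      ρ.prod (Measure.infinitePi fun _ : ℕ => Measure.infinitePi fun _ : List ℕ => ρ) := by
  have hind : iIndepFun (fun (i : List ℕ) (w : List ℕ → α) => w i)
      (Measure.infinitePi fun _ : List ℕ => ρ) :=
    iIndepFun_infinitePi (X := fun _ x => x) (by fun_prop)
  have hd : Disjoint ({[]} : Set (List ℕ)) {[]}ᶜ := disjoint_compl_right
  have h1 := indepFun_pi_of_disjoint (fun i => measurable_pi_apply i) hind hd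
  have hφ : Measurable fun u : ({[]} : Set (List ℕ)) → α => u ⟨[], Set.mem_singleton _⟩ :=
    measurable_pi_apply _
  have hψ : Measurable fun (u : ({[]}ᶜ : Set (List ℕ)) → α) (j : ℕ) (i : List ℕ) =>
      u ⟨j :: i, by simp⟩ := by fun_prop
  have h2 := h1.comp hφ hψ
  have h3 := h2.map_prod_eq_prod_map_map
    (hφ.comp (by fun_prop)).aemeasurable (hψ.comp (by fun_prop)).aemeasurable
  refine h3.trans ?_
  congr 1
  · exact Measure.infinitePi_map_eval _ _
  · refine map_infinitePi_curry ρ (φ := fun (j : ℕ) (i : List ℕ) => j :: i) ?_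
    rintro ⟨a, b⟩ ⟨c, d⟩ h
    simpa using h

end Products

/-- `U` is independent of the pair formed by `Z` and the indicator of `B`, so the joint law is a
product and Fubini integrates out `U` first. -/
theorem setIntegral_freeze {Ω α β : Type*} {m mΩ : MeasurableSpace Ω} [MeasurableSpace α]
    [MeasurableSpace β] {P : Measure Ω} [IsProbabilityMeasure P]
    (hm : m ≤ mΩ) {U : Ω → α} {Z : Ω → β} (hU : Measurable U) (hZ : Measurable[m] Z)
    (hind : Indep (MeasurableSpace.comap U inferInstance) m P)
    {F : α → β → ℝ} (hF : Measurable (fun p : α × β => F p.1 p.2)) {C : ℝ}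
    (hC : ∀ u z, |F u z| ≤ C) {B : Set Ω} (hB : MeasurableSet[m] B) :
    ∫ ω in B, F (U ω) (Z ω) ∂P = ∫ ω in B, ∫ u, F u (Z ω) ∂(P.map U) ∂P := by
  have hZ' : Measurable Z := hZ.mono hm le_rfl
  have hi : Measurable (B.indicator (fun _ => (1 : ℝ))) :=
    measurable_const.indicator (hm _ hB)
  have h1 : IndepFun U (fun ω => (Z ω, B.indicator (fun _ => (1 : ℝ)) ω)) P := by
    refine indep_of_indep_of_le_right hind ?_
    exact (hZ.prodMk (measurable_const.indicator hB)).comap_le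
  have hP : IsProbabilityMeasure (P.map U) := Measure.isProbabilityMeasure_map hU.aemeasurable
  have hQ : IsProbabilityMeasure (P.map fun ω => (Z ω, B.indicator (fun _ => (1 : ℝ)) ω)) :=
    Measure.isProbabilityMeasure_map (hZ'.prodMk hi).aemeasurable
  have h2 := h1.map_prod_eq_prod_map_map hU.aemeasurable (hZ'.prodMk hi).aemeasurable
  -- The event `B` is recorded by the last coordinate being `1`.
  let G : α × (β × ℝ) → ℝ := fun p => (if p.2.2 = 1 then 1 else 0) * F p.1 p.2.1
  have hG : Measurable G := by
    refine Measurable.mul ?_ (hF.comp (measurable_fst.prodMk (measurable_fst.comp measurable_snd)))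
    exact Measurable.ite ((measurable_snd.comp measurable_snd) (measurableSet_singleton (1 : ℝ)))
      measurable_const measurable_const
  have hGb : ∀ p, ‖G p‖ ≤ C := by
    intro p
    have := hC p.1 p.2.1
    have h0 := abs_nonneg (F p.1 p.2.1)
    simp only [G]
    split_ifs <;> simp <;> linarith
  have key : ∫ ω, G (U ω, (Z ω, B.indicator (fun _ => (1 : ℝ)) ω)) ∂P =
      ∫ ω, ∫ u, G (u, (Z ω, B.indicator (fun _ => (1 : ℝ)) ω)) ∂(P.map U) ∂P := by
    rw [← integral_map (hU.prodMk (hZ'.prodMk hi)).aemeasurable hG.aestronglyMeasurable, h2,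
      integral_prod_symm _ (Integrable.of_bound hG.aestronglyMeasurable C (ae_of_all _ hGb)),
      integral_map (hZ'.prodMk hi).aemeasurable]
    exact (hG.stronglyMeasurable.integral_prod_left'
      (μ := P.map U)).aestronglyMeasurable
  rw [← integral_indicator (hm _ hB), ← integral_indicator (hm _ hB)]
  convert key using 2 <;> ext ω
  · by_cases h : ω ∈ B <;> simp [G, h]
  · by_cases h : ω ∈ B <;> simp [G, h]

/-! ### Reverse martingale convergence. -/

section ReverseMartingale

/-- A limsup ignores initial terms, so the limsup of the versions `g n` is measurable for every `F
k`; almost surely all versions agree with `f`. -/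
theorem aestronglyMeasurable_iInf {Ω : Type*} {mΩ : MeasurableSpace Ω} {P : Measure Ω}
    {F : ℕ → MeasurableSpace Ω} (hanti : Antitone F) {f : Ω → ℝ}
    (h : ∀ n, AEStronglyMeasurable[F n] f P) : AEStronglyMeasurable[⨅ n, F n] f P := by
  choose g hg hfg using h
  have hm : Measurable[⨅ n, F n] fun ω => limsup (fun n => g n ω) atTop := by
    intro s hs
    rw [MeasurableSpace.measurableSet_iInf]
    intro k
    have : (fun ω => limsup (fun n => g n ω) atTop) =
        fun ω => limsup (fun n => g (n + k) ω) atTop := by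
      ext ω
      exact (limsup_nat_add (fun n => g n ω) k).symm
    rw [this]
    refine Measurable.limsup (mδ := F k) (fun n => ?_) hs
    exact (hg (n + k)).measurable.mono (hanti (Nat.le_add_left k n)) le_rfl
  refine ⟨_, hm.stronglyMeasurable, ?_⟩
  filter_upwards [ae_all_iff.2 hfg] with ω hω
  simp [← hω]

/-- In `L²` conditional expectations are orthogonal projections, here onto decreasing closed
subspaces with intersection the functions measurable for `⨅ n, F n`. Projections onto such subspaces
converge strongly, and `L²` dominates `L¹` on a probability space. -/
theorem tendsto_integral_abs_condExp_sub {Ω : Type*} {mΩ : MeasurableSpace Ω} {P : Measure Ω}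
    [IsProbabilityMeasure P] {F : ℕ → MeasurableSpace Ω} (hanti : Antitone F) (hF : ∀ n, F n ≤ mΩ)
    {f : Ω → ℝ} (hf : MemLp f 2 P) :
    Tendsto (fun n => ∫ ω, |P[f | F n] ω - P[f | ⨅ n, F n] ω| ∂P) atTop (𝓝 0) := by
  have hle : ⨅ n, F n ≤ mΩ := (iInf_le _ 0).trans (hF 0)
  have hfact : ∀ n, Fact (F n ≤ mΩ) := fun n => ⟨hF n⟩
  have hfact' : Fact (⨅ n, F n ≤ mΩ) := ⟨hle⟩
  let K : ℕ → Submodule ℝ (Lp ℝ 2 P) := fun n => lpMeas ℝ ℝ (F n) 2 P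
  have hKmem : ∀ n (g : Lp ℝ 2 P), g ∈ K n ↔ AEStronglyMeasurable[F n] g P := fun n g =>
    mem_lpMeas_iff_aestronglyMeasurable
  have hKanti : Antitone K := fun a b hab g hg => by
    rw [hKmem] at hg ⊢
    exact hg.mono (hanti hab)
  let x : Lp ℝ 2 P := hf.toLp f
  have hproj : ∀ n, ((K n).starProjection x : Ω → ℝ) =ᵐ[P] P[f | F n] := fun n =>
    hf.condExpL2_ae_eq_condExp (𝕜 := ℝ) (hF n)
  have hproj' : ((lpMeas ℝ ℝ (⨅ n, F n) 2 P).starProjection x : Ω → ℝ) =ᵐ[P] P[f | ⨅ n, F n] :=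
    hf.condExpL2_ae_eq_condExp (𝕜 := ℝ) hle
  have hlim : Tendsto (fun n => (K n).starProjection x) atTop
      (𝓝 ((lpMeas ℝ ℝ (⨅ n, F n) 2 P).starProjection x)) := by
    -- The orthogonal complements increase, so convergence is proved for them and subtracted from
    -- `x`.
    have h1 := Submodule.starProjection_tendsto_closure_iSup (fun n => (K n)ᗮ)
      (fun a b hab => Submodule.orthogonal_le (hKanti hab)) x
    have h2 : (⨆ n, (K n)ᗮ).topologicalClosure = (lpMeas ℝ ℝ (⨅ n, F n) 2 P)ᗮ := by
      have : lpMeas ℝ ℝ (⨅ n, F n) 2 P = (⨆ n, (K n)ᗮ)ᗮ := by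
        rw [← Submodule.iInf_orthogonal]
        ext g
        simp only [Submodule.orthogonal_orthogonal, Submodule.mem_iInf, hKmem]
        rw [mem_lpMeas_iff_aestronglyMeasurable]
        exact ⟨fun h n => h.mono (iInf_le _ n), aestronglyMeasurable_iInf hanti⟩
      rw [this, Submodule.orthogonal_orthogonal_eq_closure]
    have h3 : (⨆ n, (K n)ᗮ).topologicalClosure.starProjection x =
        x - (lpMeas ℝ ℝ (⨅ n, F n) 2 P).starProjection x := by
      simp only [h2, Submodule.starProjection_orthogonal_val]
    rw [h3] at h1
    simp only [Submodule.starProjection_orthogonal_val] at h1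
    simpa using h1.const_sub x
  rw [tendsto_iff_norm_sub_tendsto_zero] at hlim
  refine squeeze_zero (fun n => integral_nonneg fun _ => abs_nonneg _) (fun n => ?_) hlim
  have hmem : MemLp (P[f | F n] - P[f | ⨅ n, F n]) 2 P :=
    (hf.condExp (by norm_num)).sub (hf.condExp (by norm_num))
  have hnorm : ‖(K n).starProjection x - (lpMeas ℝ ℝ (⨅ n, F n) 2 P).starProjection x‖ =
      (eLpNorm (P[f | F n] - P[f | ⨅ n, F n]) 2 P).toReal := by
    rw [Lp.norm_def]
    congr 1
    refine eLpNorm_congr_ae ((Lp.coeFn_sub _ _).trans ?_)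
    exact (hproj n).sub hproj'
  rw [hnorm]
  have h1 : ∫ ω, |P[f | F n] ω - P[f | ⨅ n, F n] ω| ∂P =
      (eLpNorm (P[f | F n] - P[f | ⨅ n, F n]) 1 P).toReal := by
    rw [eLpNorm_one_eq_lintegral_enorm, ← integral_norm_eq_lintegral_enorm hmem.1]
    rfl
  rw [h1]
  exact ENNReal.toReal_mono hmem.2.ne
    (eLpNorm_le_eLpNorm_of_exponent_le (by norm_num) hmem.1)

end ReverseMartingale

/-! ### Weak convergence on the square and conditionally independent copies. -/

section Weak

variable {S : Type*} [TopologicalSpace S] [PolishSpace S] [MeasurableSpace S] [BorelSpace S]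

/-- Measurable rectangles form a π-system that contains small neighbourhoods of every point, which
suffices for weak convergence. -/
theorem tendsto_of_tendsto_rectangles {q : ℕ → ProbabilityMeasure (S × S)}
    {lam : ProbabilityMeasure (S × S)}
    (h : ∀ A B : Set S, MeasurableSet A → MeasurableSet B →
      Tendsto (fun n => (q n : Measure (S × S)).real (A ×ˢ B)) atTop
        (𝓝 ((lam : Measure (S × S)).real (A ×ˢ B)))) :
    Tendsto q atTop (𝓝 lam) := by
  refine IsPiSystem.tendsto_probabilityMeasure_of_tendsto_of_mem
    (S := Set.image2 (· ×ˢ ·) {A : Set S | MeasurableSet A} {B : Set S | MeasurableSet B})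
    isPiSystem_prod ?_ ?_ ?_
  · rintro _ ⟨A, hA, B, hB, rfl⟩
    exact hA.prod hB
  · rintro u hu ⟨x, y⟩ hxy
    obtain ⟨A, hA, B, hB, hAB⟩ := mem_nhds_prod_iff.1 (hu.mem_nhds hxy)
    obtain ⟨A', hA', hAo, hxA⟩ := mem_nhds_iff.1 hA
    obtain ⟨B', hB', hBo, hyB⟩ := mem_nhds_iff.1 hB
    exact ⟨A' ×ˢ B', ⟨A', hAo.measurableSet, B', hBo.measurableSet, rfl⟩,
      prod_mem_nhds (hAo.mem_nhds hxA) (hBo.mem_nhds hyB), (Set.prod_mono hA' hB').trans hAB⟩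
  · rintro _ ⟨A, hA, B, hB, rfl⟩
    have := h A B hA hB
    rw [← NNReal.tendsto_coe]
    exact this

/-- The law is the average of `κ × κ` over the law of `Z`, with `κ` a regular conditional
distribution of `Y` given `Z`: two draws from `κ` that are independent given `Z`. -/
theorem exists_mixture {Ω β : Type*} {mΩ : MeasurableSpace Ω} {P : Measure Ω}
    [IsProbabilityMeasure P] [mβ : MeasurableSpace β] {Z : Ω → β} (hZ : Measurable Z) {Y : Ω → S}
    (hY : Measurable Y) :
    ∃ lam : ProbabilityMeasure (S × S), ∀ A B : Set S, MeasurableSet A → MeasurableSet B →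
      (lam : Measure (S × S)).real (A ×ˢ B) =
        ∫ ω, P[(Y ⁻¹' A).indicator (fun _ => (1 : ℝ)) | mβ.comap Z] ω *
          P[(Y ⁻¹' B).indicator (fun _ => (1 : ℝ)) | mβ.comap Z] ω ∂P := by
  have hne : Nonempty S := (nonempty_of_isProbabilityMeasure P).map Y
  let κ := condDistrib Y Z P
  have : IsProbabilityMeasure (P.map Z) := Measure.isProbabilityMeasure_map hZ.aemeasurable
  refine ⟨⟨(κ ×ₖ κ) ∘ₘ P.map Z, inferInstance⟩, fun A B hA hB => ?_⟩
  have hκ : ∀ A : Set S, MeasurableSet A → (fun ω => (κ (Z ω)).real A) =ᵐ[P]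
      P[(Y ⁻¹' A).indicator (fun _ => (1 : ℝ)) | mβ.comap Z] := fun A hA =>
    condDistrib_ae_eq_condExp hZ hY hA
  have h1 : ∫ ω, P[(Y ⁻¹' A).indicator (fun _ => (1 : ℝ)) | mβ.comap Z] ω *
      P[(Y ⁻¹' B).indicator (fun _ => (1 : ℝ)) | mβ.comap Z] ω ∂P =
      ∫ ω, ((κ (Z ω)) A * (κ (Z ω)) B).toReal ∂P := by
    refine integral_congr_ae ?_
    filter_upwards [hκ A hA, hκ B hB] with ω h1 h2
    rw [← h1, ← h2, ENNReal.toReal_mul]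
    rfl
  have hm : ∀ A : Set S, MeasurableSet A → Measurable fun ω => κ (Z ω) A := fun A hA =>
    (Kernel.measurable_coe _ hA).comp hZ
  rw [h1]
  refine Eq.trans ?_ (integral_toReal ((hm A hA).mul (hm B hB)).aemeasurable
    (ae_of_all _ fun ω => ENNReal.mul_lt_top (measure_lt_top _ _) (measure_lt_top _ _))).symm
  refine congrArg ENNReal.toReal ?_
  change ((κ ×ₖ κ) ∘ₘ P.map Z) (A ×ˢ B) = _
  rw [Measure.bind_apply (hA.prod hB) (Kernel.aemeasurable _),
    lintegral_map (Kernel.measurable_coe _ (hA.prod hB)) hZ]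
  refine lintegral_congr fun ω => ?_
  rw [Kernel.prod_apply, Measure.prod_prod, Pi.mul_apply]

theorem exists_conditionally_independent {Ω : Type*} {m mΩ : MeasurableSpace Ω} {P : Measure Ω}
    [IsProbabilityMeasure P] (hm : m ≤ mΩ) {Y : Ω → S} (hY : Measurable Y) :
    ∃ lam : ProbabilityMeasure (S × S), ∀ A B : Set S, MeasurableSet A → MeasurableSet B →
      (lam : Measure (S × S)).real (A ×ˢ B) =
        ∫ ω, P[(Y ⁻¹' A).indicator (fun _ => (1 : ℝ)) | m] ω *
          P[(Y ⁻¹' B).indicator (fun _ => (1 : ℝ)) | m] ω ∂P := by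
  -- `Z` is the identity, with target `Ω` carrying the smaller σ-algebra `m`.
  have h := exists_mixture (P := P) (mβ := m) (Z := id) (measurable_id'' hm) hY
  rwa [MeasurableSpace.comap_id] at h

end Weak

/-! ### Finite-height trees and iterates of the bivariate operator. -/

section Model

variable {E S : Type*} [MeasurableSpace E] [MeasurableSpace S]

/-- The value at the root of the recursion on the tree of height `n` with innovations `a` and
boundary values `y`. -/
def RDE.treeEval (R : RDE E S) : ℕ → (List ℕ → E × ℕ∞) → (List ℕ → S) → S
  | 0, _, y => y []
  | n + 1, a, y =>
    R.apply (a []) fun j => R.treeEval n (fun w => a (j :: w)) (fun w => y (j :: w))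

theorem RDE.measurable_treeEval (R : RDE E S) (n : ℕ) :
    Measurable fun p : (List ℕ → E × ℕ∞) × (List ℕ → S) => R.treeEval n p.1 p.2 := by
  induction n with
  | zero => exact (measurable_pi_apply _).comp measurable_snd
  | succ n ih =>
    have h0 : Measurable fun p : (List ℕ → E × ℕ∞) × (List ℕ → S) => p.1 [] :=
      (measurable_pi_apply _).comp measurable_fst
    refine R.measurable_apply.comp (h0.prodMk ?_)
    refine measurable_pi_lambda _ fun j => ih.comp (Measurable.prodMk ?_ ?_)
    · exact measurable_pi_lambda _ fun w => (measurable_pi_apply _).comp measurable_fst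
    · exact measurable_pi_lambda _ fun w => (measurable_pi_apply _).comp measurable_snd

theorem RDE.treeEval_congr (R : RDE E S) {n : ℕ} {a a' : List ℕ → E × ℕ∞} {y y' : List ℕ → S}
    (ha : ∀ w, w.length < n → a w = a' w) (hy : ∀ w, w.length = n → y w = y' w) :
    R.treeEval n a y = R.treeEval n a' y' := by
  induction n generalizing a a' y y' with
  | zero => exact hy [] rfl
  | succ n ih =>
    simp only [RDE.treeEval]
    rw [ha [] (by simp)]
    congr 1
    ext j
    exact ih (fun w hw => ha _ (by simpa using hw)) (fun w hw => hy _ (by simpa using hw))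

/-- The values at the roots of two trees of height `n`, as a function of the field of all
innovations and boundary values. -/
def RDE.treeEvalPair (R : RDE E S) (n : ℕ)
    (w : List ℕ → ((E × ℕ∞) × (E × ℕ∞)) × (S × S)) : S × S :=
  (R.treeEval n (fun i => (w i).1.1) (fun i => (w i).2.1),
    R.treeEval n (fun i => (w i).1.2) (fun i => (w i).2.2))

theorem RDE.measurable_treeEvalPair (R : RDE E S) (n : ℕ) : Measurable (R.treeEvalPair n) :=
  ((R.measurable_treeEval n).comp (Measurable.prodMk
      (f := fun (w : List ℕ → ((E × ℕ∞) × (E × ℕ∞)) × (S × S)) i => (w i).1.1)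
      (g := fun w i => (w i).2.1) (by fun_prop) (by fun_prop))).prodMk
    ((R.measurable_treeEval n).comp (Measurable.prodMk
      (f := fun (w : List ℕ → ((E × ℕ∞) × (E × ℕ∞)) × (S × S)) i => (w i).1.2)
      (g := fun w i => (w i).2.2) (by fun_prop) (by fun_prop)))

/-- The joint law of the innovations. -/
noncomputable def RDE.innovLaw (R : RDE E S) : Measure (List ℕ → E × ℕ∞) :=
  Measure.infinitePi fun _ => (R.law : Measure (E × ℕ∞))

instance (R : RDE E S) : IsProbabilityMeasure R.innovLaw := by
  unfold RDE.innovLaw; infer_instance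

theorem RDE.biOp_toMeasure (R : RDE E S) (lam : ProbabilityMeasure (S × S)) :
    (R.biOp lam : Measure (S × S)) =
      (((R.law : Measure (E × ℕ∞)).prod (R.law : Measure (E × ℕ∞))).prod
        (Measure.infinitePi fun _ : ℕ => (lam : Measure (S × S)))).map R.applyPair := rfl

/-- One more application of `T ⊗ T` puts a root above i.i.d. copies of the tree of height `n`. The
field carries both innovations and boundary values at every vertex; `treeEvalPair` reads only those
it needs. -/
theorem RDE.biOp_iterate_eq_map (R : RDE E S) (lam : ProbabilityMeasure (S × S)) (n : ℕ) :
    (R.biOp^[n] lam : Measure (S × S)) =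
      (Measure.infinitePi fun _ : List ℕ =>
        ((R.law : Measure (E × ℕ∞)).prod (R.law : Measure (E × ℕ∞))).prod
          (lam : Measure (S × S))).map (R.treeEvalPair n) := by
  set ρ := ((R.law : Measure (E × ℕ∞)).prod (R.law : Measure (E × ℕ∞))).prod
    (lam : Measure (S × S)) with hρ
  induction n with
  | zero =>
    have h1 : R.treeEvalPair 0 = fun w => (w []).2 := rfl
    have h2 := Measure.infinitePi_map_eval (fun _ : List ℕ => ρ) []
    rw [h1]
    calc (lam : Measure (S × S)) = ρ.map Prod.snd := by
          rw [hρ, Measure.map_snd_prod]; simp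
      _ = _ := by
          conv_lhs => rw [← h2]
          rw [Measure.map_map measurable_snd (measurable_pi_apply _)]
          rfl
  | succ n ih =>
    rw [Function.iterate_succ_apply', R.biOp_toMeasure, ih,
      ← Measure.infinitePi_map_pi (fun _ : ℕ => Measure.infinitePi fun _ : List ℕ => ρ)
        (fun _ => R.measurable_treeEvalPair n)]
    have h1 : (R.law : Measure (E × ℕ∞)).prod (R.law : Measure (E × ℕ∞)) = ρ.map Prod.fst := by
      rw [hρ, Measure.map_fst_prod]; simp
    have hm : Measurable fun (x : ℕ → List ℕ → ((E × ℕ∞) × (E × ℕ∞)) × (S × S)) i =>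
        R.treeEvalPair n (x i) :=
      measurable_pi_lambda _ fun i => (R.measurable_treeEvalPair n).comp (measurable_pi_apply i)
    rw [h1, Measure.map_prod_map _ _ measurable_fst hm, ← map_cons_infinitePi,
      Measure.map_map (measurable_fst.prodMap hm) (by fun_prop),
      Measure.map_map R.measurable_applyPair ((measurable_fst.prodMap hm).comp (by fun_prop))]
    rfl

/-- The conditional expectation of `f` of the root given the values `y` in generation `n`. -/
noncomputable def RDE.condMean (R : RDE E S) (n : ℕ) (f : S → ℝ) (y : List ℕ → S) : ℝ :=
  ∫ a, f (R.treeEval n a y) ∂(R.innovLaw)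

theorem RDE.measurable_condMean (R : RDE E S) (n : ℕ) {f : S → ℝ} (hf : Measurable f) :
    Measurable (R.condMean n f) :=
  ((hf.comp (R.measurable_treeEval n)).stronglyMeasurable.integral_prod_left'
    (μ := R.innovLaw)).measurable

theorem RDE.condMean_congr (R : RDE E S) {n : ℕ} (f : S → ℝ) {y y' : List ℕ → S}
    (hy : ∀ w, w.length = n → y w = y' w) : R.condMean n f y = R.condMean n f y' := by
  unfold RDE.condMean
  simp_rw [fun a => R.treeEval_congr (n := n) (a := a) (fun _ _ => rfl) hy]

theorem RDE.integrable_comp_treeEval (R : RDE E S) (n : ℕ) {f : S → ℝ} (hf : Measurable f) {C : ℝ}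
    (hC : ∀ x, |f x| ≤ C) (y : List ℕ → S) :
    Integrable (fun a => f (R.treeEval n a y)) R.innovLaw :=
  Integrable.of_bound ((hf.comp ((R.measurable_treeEval n).comp
    (measurable_id.prodMk measurable_const))).aestronglyMeasurable) C (ae_of_all _ fun _ => hC _)

theorem RDE.abs_condMean_le (R : RDE E S) (n : ℕ) {f : S → ℝ} {C : ℝ} (hC : ∀ x, |f x| ≤ C)
    (y : List ℕ → S) : |R.condMean n f y| ≤ C := by
  have := norm_integral_le_of_norm_le_const (μ := R.innovLaw)
    (f := fun a => f (R.treeEval n a y)) (C := C) (ae_of_all _ fun _ => hC _)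
  simpa [RDE.condMean] using this

theorem RDE.condMean_const (R : RDE E S) (n : ℕ) (c : ℝ) (y : List ℕ → S) :
    R.condMean n (fun _ => c) y = c := by
  simp [RDE.condMean]

theorem RDE.condMean_sub (R : RDE E S) (n : ℕ) {f g : S → ℝ} (hf : Measurable f)
    (hg : Measurable g) {C D : ℝ} (hC : ∀ x, |f x| ≤ C) (hD : ∀ x, |g x| ≤ D) (y : List ℕ → S) :
    R.condMean n f y - R.condMean n g y = R.condMean n (fun x => f x - g x) y :=
  (integral_sub (R.integrable_comp_treeEval n hf hC y)
    (R.integrable_comp_treeEval n hg hD y)).symm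

theorem RDE.abs_condMean_le_condMean_abs (R : RDE E S) (n : ℕ) (f : S → ℝ) (y : List ℕ → S) :
    |R.condMean n f y| ≤ R.condMean n (fun x => |f x|) y :=
  abs_integral_le_integral_abs

/-- With the boundary pairs fixed, the two trees depend on independent innovation fields, so the
inner integral factorizes. -/
theorem RDE.integral_biOp_iterate (R : RDE E S) (lam : ProbabilityMeasure (S × S)) (n : ℕ)
    {f g : S → ℝ} (hf : Measurable f) (hg : Measurable g) {C D : ℝ} (hC : ∀ x, |f x| ≤ C)
    (hD : ∀ x, |g x| ≤ D) :
    ∫ p, f p.1 * g p.2 ∂(R.biOp^[n] lam : Measure (S × S)) =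
      ∫ z, R.condMean n f (fun i => (z i).1) * R.condMean n g (fun i => (z i).2)
        ∂(Measure.infinitePi fun _ : List ℕ => (lam : Measure (S × S))) := by
  have hfg : Measurable fun p : S × S => f p.1 * g p.2 :=
    (hf.comp measurable_fst).mul (hg.comp measurable_snd)
  have hlaw : (Measure.infinitePi fun _ : List ℕ =>
      ((R.law : Measure (E × ℕ∞)).prod (R.law : Measure (E × ℕ∞))).prod
        (lam : Measure (S × S))) =
      ((R.innovLaw.prod R.innovLaw).prod
        (Measure.infinitePi fun _ : List ℕ => (lam : Measure (S × S)))).map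
        (fun p i => ((p.1.1 i, p.1.2 i), p.2 i)) := by
    rw [← map_zip_infinitePi, ← map_zip_infinitePi]
    conv_lhs => rw [← Measure.map_id (μ := Measure.infinitePi fun _ : List ℕ =>
      (lam : Measure (S × S)))]
    rw [Measure.map_prod_map _ _ (by fun_prop) measurable_id,
      Measure.map_map (by fun_prop) (by fun_prop)]
    rfl
  have hm : Measurable fun (p : ((List ℕ → E × ℕ∞) × (List ℕ → E × ℕ∞)) × (List ℕ → S × S))
      (i : List ℕ) => ((p.1.1 i, p.1.2 i), p.2 i) := by fun_prop
  rw [R.biOp_iterate_eq_map, integral_map (R.measurable_treeEvalPair n).aemeasurable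
    hfg.aestronglyMeasurable, hlaw, integral_map hm.aemeasurable
    (f := fun w => f (R.treeEvalPair n w).1 * g (R.treeEvalPair n w).2)
    (hfg.comp (R.measurable_treeEvalPair n)).aestronglyMeasurable, integral_prod_symm]
  · refine integral_congr_ae (ae_of_all _ fun z => ?_)
    exact integral_prod_mul (μ := R.innovLaw) (ν := R.innovLaw)
      (fun a => f (R.treeEval n a fun i => (z i).1))
      (fun a => g (R.treeEval n a fun i => (z i).2))
  · refine Integrable.of_bound ((hfg.comp (R.measurable_treeEvalPair n)).comp
      hm).aestronglyMeasurable (C * D) (ae_of_all _ fun p => ?_)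
    simp only [norm_mul, Real.norm_eq_abs]
    exact mul_le_mul (hC _) (hD _) (abs_nonneg _) ((abs_nonneg _).trans (hC (R.treeEval n p.1.1
      fun i => (p.2 i).1)))

end Model

/-! ### Conditioning in the recursive tree process. -/

section RTP

/-- The extension by a constant of a family indexed by a subtype. -/
noncomputable def extendConst {ι T : Type*} (p : ι → Prop) (c : T) (u : {i // p i} → T) (i : ι) :
    T :=
  open Classical in if h : p i then u ⟨i, h⟩ else c

theorem extendConst_of_pos {ι T : Type*} (p : ι → Prop) (c : T) (u : {i // p i} → T) {i : ι}
    (h : p i) : extendConst p c u i = u ⟨i, h⟩ := dif_pos h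

theorem measurable_extendConst {ι T : Type*} [MeasurableSpace T] (p : ι → Prop) (c : T) :
    Measurable (extendConst p c) := by
  refine measurable_pi_lambda _ fun i => ?_
  by_cases h : p i
  · simp only [extendConst, h, dite_true]
    exact measurable_pi_apply _
  · simp only [extendConst, h, dite_false]
    exact measurable_const

variable {E S Ω : Type*} [MeasurableSpace E] [MeasurableSpace S] {mΩ : MeasurableSpace Ω}

theorem sigmaFrom_le {X : List ℕ → Ω → S} (hX : ∀ i, Measurable (X i)) (n : ℕ) :
    sigmaFrom X n ≤ mΩ :=
  iSup₂_le fun i _ => (hX i).comap_le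

theorem sigmaFrom_antitone (X : List ℕ → Ω → S) : Antitone (sigmaFrom X) := fun _ _ hab =>
  iSup₂_le fun i hi => le_iSup₂_of_le i (hab.trans hi) le_rfl

theorem measurable_sigmaFrom (X : List ℕ → Ω → S) {n : ℕ} {i : List ℕ} (hi : n ≤ i.length) :
    Measurable[sigmaFrom X n] (X i) :=
  Measurable.of_comap_le (le_iSup₂_of_le i hi le_rfl)

/-- Subtrees rooted at distinct words of one length use disjoint sets of innovations. The common
length is what makes `(i, w) ↦ i ++ w` injective. -/
theorem RDE.integral_prod_treeEval (R : RDE E S) {d : ℕ} (k : ℕ)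
    {I : Finset (List ℕ)} (hI : ∀ i ∈ I, i.length = d) {f : List ℕ → S → ℝ}
    (hf : ∀ i, Measurable (f i)) (z : List ℕ → List ℕ → S) :
    ∫ a, ∏ i ∈ I, f i (R.treeEval k (fun w => a (i ++ w)) (z i)) ∂(R.innovLaw) =
      ∏ i ∈ I, R.condMean k (f i) (z i) := by
  have hinj : Function.Injective (fun p : I × List ℕ => (p.1 : List ℕ) ++ p.2) := by
    rintro ⟨⟨i, hi⟩, w⟩ ⟨⟨j, hj⟩, v⟩ h
    have := List.append_inj h ((hI i hi).trans (hI j hj).symm)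
    simpa using this
  have h := map_infinitePi_curry (R.law : Measure (E × ℕ∞))
    (φ := fun (i : I) (w : List ℕ) => (i : List ℕ) ++ w) hinj
  rw [Measure.infinitePi_eq_pi (ι := I)] at h
  have hm : ∀ i : I, Measurable fun a => f i (R.treeEval k a (z i)) := fun i =>
    (hf i).comp ((R.measurable_treeEval k).comp (measurable_id.prodMk measurable_const))
  have hprod : Measurable fun b : I → List ℕ → E × ℕ∞ =>
      ∏ i : I, f i (R.treeEval k (b i) (z i)) :=
    Finset.measurable_fun_prod _ fun i _ => (hm i).comp (measurable_pi_apply i)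
  have hφ : Measurable fun (a : List ℕ → E × ℕ∞) (i : I) (w : List ℕ) => a (i ++ w) := by
    fun_prop
  calc ∫ a, ∏ i ∈ I, f i (R.treeEval k (fun w => a (i ++ w)) (z i)) ∂(R.innovLaw)
      = ∫ a, ∏ i : I, f i (R.treeEval k (fun w => a (i ++ w)) (z i)) ∂(R.innovLaw) := by
        refine integral_congr_ae (ae_of_all _ fun a => ?_)
        exact (Finset.prod_coe_sort I
          fun i => f i (R.treeEval k (fun w => a (i ++ w)) (z i))).symm
    _ = ∫ b, ∏ i : I, f i (R.treeEval k (b i) (z i)) ∂(Measure.pi fun _ : I => R.innovLaw) := by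
        rw [RDE.innovLaw, ← h, integral_map hφ.aemeasurable hprod.aestronglyMeasurable]
    _ = ∏ i : I, R.condMean k (f i) (z i) :=
        integral_fintype_prod_eq_prod (fun (i : I) a => f i (R.treeEval k a (z i)))
    _ = _ := Finset.prod_coe_sort I fun i => R.condMean k (f i) (z i)

namespace IsInvariantRTP

variable {P : Measure Ω} {R : RDE E S} {μ : ProbabilityMeasure S}
  {innov : List ℕ → Ω → E × ℕ∞} {X : List ℕ → Ω → S} (hX : IsInvariantRTP R μ P innov X)

include hX

theorem ae_eq_treeEval : ∀ᵐ ω ∂P, ∀ (n : ℕ) (i : List ℕ),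
    X i ω = R.treeEval n (fun w => innov (i ++ w) ω) (fun w => X (i ++ w) ω) := by
  filter_upwards [ae_all_iff.2 hX.recursion] with ω hω n
  induction n with
  | zero => intro i; simp [RDE.treeEval]
  | succ n ih =>
    intro i
    rw [hω i]
    simp only [RDE.treeEval, List.append_nil]
    congr 1
    ext j
    rw [ih (i ++ [j])]
    simp

theorem map_innov : P.map (fun ω i => innov i ω) = R.innovLaw := by
  rw [hX.innov_indep.map_fun_eq_infinitePi_map hX.measurable_innov]
  simp only [hX.innov_law]
  rfl

variable [IsProbabilityMeasure P]

theorem exists_measurable_range (n m : ℕ) :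
    ∃ φ : ({i : List ℕ // i.length = m} → S) ×
      ({i : List ℕ // n ≤ i.length ∧ i.length < m} → E × ℕ∞) →
      {i : List ℕ // n ≤ i.length ∧ i.length ≤ m} → S, Measurable φ ∧
      (fun ω => φ (fun i => X i ω, fun i => innov i ω)) =ᵐ[P] fun ω i => X i ω := by
  obtain ⟨e⟩ := (nonempty_of_isProbabilityMeasure P).map (innov [])
  obtain ⟨x⟩ := (nonempty_of_isProbabilityMeasure P).map (X [])
  refine ⟨fun p i => R.treeEval (m - i.1.length) (fun w => extendConst _ e p.2 (i ++ w))
      (fun w => extendConst _ x p.1 (i ++ w)), ?_, ?_⟩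
  · refine measurable_pi_lambda _ fun i => (R.measurable_treeEval _).comp (Measurable.prodMk ?_ ?_)
    · exact measurable_pi_lambda _ fun w =>
        (measurable_pi_apply (i.1 ++ w)).comp ((measurable_extendConst _ e).comp measurable_snd)
    · exact measurable_pi_lambda _ fun w =>
        (measurable_pi_apply (i.1 ++ w)).comp ((measurable_extendConst _ x).comp measurable_fst)
  · filter_upwards [hX.ae_eq_treeEval] with ω hω
    ext i
    obtain ⟨h1, h2⟩ := i.2
    rw [hω (m - i.1.length) i.1]
    refine R.treeEval_congr (fun w hw => ?_) (fun w hw => ?_)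
    · exact extendConst_of_pos _ _ _ (by simp only [List.length_append]; omega)
    · exact extendConst_of_pos _ _ _ (by simp only [List.length_append]; omega)

/-- Generation `n + k` is independent of all innovations before it, and those of generations in `[n,
n + k)` are independent of those before `n`. The intermediate generations are a function of the
first two blocks, up to a null set. -/
theorem indepFun_range (n k : ℕ) :
    IndepFun (fun ω (i : {i : List ℕ // n ≤ i.length ∧ i.length ≤ n + k}) => X i ω)
      (fun ω (i : {i : List ℕ // i.length < n}) => innov i ω) P := by
  let U : Ω → {i : List ℕ // i.length = n + k} → S := fun ω i => X i ω
  let V : Ω → {i : List ℕ // n ≤ i.length ∧ i.length < n + k} → E × ℕ∞ := fun ω i => innov i ω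
  let W : Ω → {i : List ℕ // i.length < n} → E × ℕ∞ := fun ω i => innov i ω
  have hU : Measurable U := measurable_pi_lambda _ fun i => hX.measurable_X i
  have hV : Measurable V := measurable_pi_lambda _ fun i => hX.measurable_innov i
  have hW : Measurable W := measurable_pi_lambda _ fun i => hX.measurable_innov i
  have h1 : IndepFun U (fun ω => (V ω, W ω)) P := by
    have hψ : Measurable fun u : {i : List ℕ // i.length < n + k} → E × ℕ∞ =>
        ((fun i => u ⟨i, i.2.2⟩ : {i : List ℕ // n ≤ i.length ∧ i.length < n + k} → E × ℕ∞),
          (fun i => u ⟨i, i.2.trans_le (Nat.le_add_right n k)⟩ :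
            {i : List ℕ // i.length < n} → E × ℕ∞)) := by fun_prop
    exact (hX.X_indep_innov (n + k)).comp measurable_id hψ
  have h2 : IndepFun V W P := by
    refine indepFun_pi_of_disjoint hX.measurable_innov hX.innov_indep
      (s := {i : List ℕ | n ≤ i.length ∧ i.length < n + k}) (t := {i : List ℕ | i.length < n}) ?_
    exact Set.disjoint_left.2 fun i hi hi' => absurd hi.1 (not_le.2 hi')
  obtain ⟨φ, hφ, hφX⟩ := hX.exists_measurable_range n (n + k)
  exact ((indepFun_prodMk_of_indepFun hU hV hW h1 h2).comp hφ measurable_id).congr hφX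
    (ae_eq_refl _)

theorem indep_innov_sigmaFrom (n : ℕ) :
    Indep (MeasurableSpace.comap (fun ω (i : {i : List ℕ // i.length < n}) => innov i ω)
      inferInstance) (sigmaFrom X n) P := by
  let G : ℕ → MeasurableSpace Ω := fun k => MeasurableSpace.comap
    (fun ω (i : {i : List ℕ // n ≤ i.length ∧ i.length ≤ n + k}) => X i ω) inferInstance
  have hG : ∀ k, G k = ⨆ (i : {i : List ℕ // n ≤ i.length ∧ i.length ≤ n + k}),
      MeasurableSpace.comap (X i) inferInstance := fun k => MeasurableSpace.comap_process_pi _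
  have hmono : Monotone G := by
    intro a b hab
    simp only [hG]
    exact iSup_le fun i => le_iSup_of_le (⟨i.1, i.2.1, by have := i.2.2; omega⟩ :
      {i : List ℕ // n ≤ i.length ∧ i.length ≤ n + b}) le_rfl
  have hle : ∀ k, G k ≤ mΩ := fun k =>
    Measurable.comap_le (measurable_pi_lambda _ fun i => hX.measurable_X i)
  have hW : Measurable (fun ω (i : {i : List ℕ // i.length < n}) => innov i ω) :=
    measurable_pi_lambda _ fun i => hX.measurable_innov i
  have h := indep_iSup_of_monotone (fun k => hX.indepFun_range n k) hle hW.comap_le hmono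
  refine (indep_of_indep_of_le_left h ?_).symm
  refine iSup₂_le fun i hi => le_iSup_of_le (i.length - n) ?_
  refine le_of_le_of_eq ?_ (hG (i.length - n)).symm
  exact le_iSup_of_le (⟨i, hi, by omega⟩ :
    {j : List ℕ // n ≤ j.length ∧ j.length ≤ n + (i.length - n)}) le_rfl

/-- The boundary in generation `d + k` and the event `B` are frozen, since the innovations of
earlier generations are independent of `sigmaFrom X (d + k)`; averaging over these then splits along
the disjoint subtrees. Allowing several vertices is what later yields independence of a whole
generation from the tail. -/
theorem setIntegral_prod_eq {d k : ℕ} {I : Finset (List ℕ)} (hI : ∀ i ∈ I, i.length = d)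
    {f : List ℕ → S → ℝ} (hf : ∀ i, Measurable (f i)) {C : ℝ} (hC : ∀ i x, |f i x| ≤ C) {B : Set Ω}
    (hB : MeasurableSet[sigmaFrom X (d + k)] B) :
    ∫ ω in B, ∏ i ∈ I, f i (X i ω) ∂P =
      ∫ ω in B, ∏ i ∈ I, R.condMean k (f i) (fun w => X (i ++ w) ω) ∂P := by
  obtain ⟨e⟩ := (nonempty_of_isProbabilityMeasure P).map (innov [])
  obtain ⟨x⟩ := (nonempty_of_isProbabilityMeasure P).map (X [])
  -- Innovations from generation `d + k` on are overwritten by the constant `e`, as they need not be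
  -- independent of `sigmaFrom X (d + k)`.
  let tr : (List ℕ → E × ℕ∞) → (List ℕ → E × ℕ∞) := fun a =>
    extendConst (fun i : List ℕ => i.length < d + k) e fun i => a i
  have htr : Measurable tr :=
    (measurable_extendConst _ _).comp (measurable_pi_lambda _ fun i => measurable_pi_apply _)
  have htr' : ∀ a i, i.length < d + k → tr a i = a i := fun a i hi =>
    extendConst_of_pos (fun i : List ℕ => i.length < d + k) _ _ hi
  let U : Ω → List ℕ → E × ℕ∞ := fun ω => tr fun i => innov i ω
  let Z : Ω → List ℕ → S := fun ω =>
    extendConst (fun i : List ℕ => i.length = d + k) x fun i => X i ω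
  have hZ' : ∀ ω i, i.length = d + k → Z ω i = X i ω := fun ω i hi =>
    extendConst_of_pos (fun i : List ℕ => i.length = d + k) _ _ hi
  have hinnov : Measurable fun ω i => innov i ω := measurable_pi_lambda _ hX.measurable_innov
  have hU : Measurable U := htr.comp hinnov
  have hZ : Measurable[sigmaFrom X (d + k)] Z :=
    (measurable_extendConst _ _).comp (@measurable_pi_lambda _ _ _ (sigmaFrom X (d + k)) _ _
      fun i => measurable_sigmaFrom X i.2.ge)
  have hind : Indep (MeasurableSpace.comap U inferInstance) (sigmaFrom X (d + k)) P := by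
    refine indep_of_indep_of_le_left (hX.indep_innov_sigmaFrom (d + k)) ?_
    exact ((measurable_extendConst _ _).comp (comap_measurable _)).comap_le
  let F : (List ℕ → E × ℕ∞) → (List ℕ → S) → ℝ := fun u z =>
    ∏ i ∈ I, f i (R.treeEval k (fun w => u (i ++ w)) (fun w => z (i ++ w)))
  have hF : Measurable fun p : (List ℕ → E × ℕ∞) × (List ℕ → S) => F p.1 p.2 := by
    refine Finset.measurable_fun_prod _ fun i _ => (hf i).comp ?_
    refine (R.measurable_treeEval k).comp (Measurable.prodMk
      (f := fun (p : (List ℕ → E × ℕ∞) × (List ℕ → S)) (w : List ℕ) => p.1 (i ++ w))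
      (g := fun p w => p.2 (i ++ w)) (by fun_prop) (by fun_prop))
  have hFC : ∀ u z, |F u z| ≤ ∏ _i ∈ I, C := fun u z => by
    rw [Finset.abs_prod]
    exact Finset.prod_le_prod (fun _ _ => abs_nonneg _) fun i _ => hC i _
  have h := setIntegral_freeze (sigmaFrom_le hX.measurable_X (d + k)) hU hZ hind hF hFC hB
  have hle := sigmaFrom_le hX.measurable_X (d + k)
  refine Eq.trans (setIntegral_congr_ae (hle _ hB) ?_) (h.trans
    (setIntegral_congr_fun (hle _ hB) fun ω _ => ?_))
  · filter_upwards [hX.ae_eq_treeEval] with ω hω _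
    refine Finset.prod_congr rfl fun i hi => ?_
    rw [hω k i]
    congr 1
    refine R.treeEval_congr (fun w hw => ?_) (fun w hw => ?_)
    · exact (htr' (fun i => innov i ω) (i ++ w)
        (by have := hI i hi; simp only [List.length_append]; omega)).symm
    · exact (hZ' _ (i ++ w) (by rw [List.length_append, hI i hi, hw])).symm
  · have hFm : Measurable fun u => F u (Z ω) := hF.comp (g := fun p => F p.1 p.2)
      (measurable_id.prodMk (measurable_const (a := Z ω)))
    have hmap : P.map U = R.innovLaw.map tr := by
      rw [← hX.map_innov, Measure.map_map htr hinnov]; rfl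
    simp only [hmap]
    rw [integral_map htr.aemeasurable hFm.aestronglyMeasurable]
    have h1 : ∀ a, F (tr a) (Z ω) =
        ∏ i ∈ I, f i (R.treeEval k (fun w => a (i ++ w)) (fun w => X (i ++ w) ω)) := by
      intro a
      refine Finset.prod_congr rfl fun i hi => ?_
      congr 1
      refine R.treeEval_congr (fun w hw => ?_) (fun w hw => ?_)
      · exact htr' _ (i ++ w) (by have := hI i hi; simp only [List.length_append]; omega)
      · exact hZ' _ (i ++ w) (by rw [List.length_append, hI i hi, hw])
    simp only [h1]
    exact R.integral_prod_treeEval k hI hf fun i w => X (i ++ w) ω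

/-- The whole process is not i.i.d., but a single generation is; hence the restriction to functions
of one level, for which the process may be replaced by an i.i.d. field. -/
theorem integral_level {n : ℕ} (i : List ℕ) {F : (List ℕ → S) → ℝ} (hF : Measurable F)
    (hlev : ∀ y y' : List ℕ → S, (∀ w, w.length = n → y w = y' w) → F y = F y') :
    ∫ ω, F (fun w => X (i ++ w) ω) ∂P =
      ∫ y, F y ∂(Measure.infinitePi fun _ : List ℕ => (μ : Measure S)) := by
  obtain ⟨x⟩ := (nonempty_of_isProbabilityMeasure P).map (X [])
  let G : ({w : List ℕ // w.length = n} → S) → ℝ := fun u => F (extendConst _ x u)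
  have hG : Measurable G := hF.comp (measurable_extendConst _ _)
  have hGF : ∀ y, F y = G fun w => y w := fun y =>
    hlev _ _ fun w hw =>
      (extendConst_of_pos (fun w : List ℕ => w.length = n) x (fun w => y w) hw).symm
  have hind : iIndepFun (fun (w : {w : List ℕ // w.length = n}) ω => X (i ++ w) ω) P := by
    have := (hX.X_indep (i.length + n)).precomp
      (g := fun w : {w : List ℕ // w.length = n} => ⟨i ++ w, by simp [w.2]⟩)
      (fun v w h => Subtype.ext (List.append_cancel_left (Subtype.ext_iff.1 h)))
    exact this
  have h1 := hind.map_fun_eq_infinitePi_map (fun w => hX.measurable_X _)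
  simp only [hX.X_law] at h1
  have h2 := Measure.map_infinitePi_infinitePi_of_inj (P := fun _ : List ℕ => (μ : Measure S))
    (Subtype.val_injective (p := fun w : List ℕ => w.length = n))
  simp only [hGF]
  rw [← integral_map (μ := P)
    (φ := fun ω (w : {w : List ℕ // w.length = n}) => X (i ++ w) ω)
    (measurable_pi_lambda _ fun w => hX.measurable_X _).aemeasurable hG.aestronglyMeasurable,
    h1, ← h2, integral_map (Measurable.aemeasurable (by fun_prop)) hG.aestronglyMeasurable]

theorem condExp_root_eq {n : ℕ} {f : S → ℝ} (hf : Measurable f) {C : ℝ}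
    (hC : ∀ x, |f x| ≤ C) :
    P[fun ω => f (X [] ω) | sigmaFrom X n] =ᵐ[P] fun ω => R.condMean n f (fun w => X w ω) := by
  obtain ⟨x⟩ := (nonempty_of_isProbabilityMeasure P).map (X [])
  have hle := sigmaFrom_le hX.measurable_X n
  have hXm : Measurable fun ω w => X w ω := measurable_pi_lambda _ hX.measurable_X
  refine (ae_eq_condExp_of_forall_setIntegral_eq hle ?_ ?_ ?_ ?_).symm
  · exact Integrable.of_bound (hf.comp (hX.measurable_X _)).aestronglyMeasurable C
      (ae_of_all _ fun _ => hC _)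
  · intro s _ _
    exact (Integrable.of_bound ((R.measurable_condMean n hf).comp hXm).aestronglyMeasurable C
      (ae_of_all _ fun _ => R.abs_condMean_le n hC _)).integrableOn
  · intro B hB _
    -- The root is the single vertex of generation `0`.
    have := hX.setIntegral_prod_eq (d := 0) (k := n) (I := {[]}) (by simp) (fun _ => hf)
      (fun _ => hC) (B := B) (by rwa [Nat.zero_add])
    simpa using this.symm
  · refine StronglyMeasurable.aestronglyMeasurable (Measurable.stronglyMeasurable ?_)
    have h1 : Measurable[sigmaFrom X n] fun ω =>
        extendConst (fun i : List ℕ => i.length = n) x fun i => X i ω :=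
      (measurable_extendConst _ _).comp (@measurable_pi_lambda _ _ _ (sigmaFrom X n) _ _
        fun i => measurable_sigmaFrom X i.2.ge)
    have h2 := (R.measurable_condMean n hf).comp h1
    convert h2 using 1
    ext ω
    exact R.condMean_congr f fun w hw =>
      (extendConst_of_pos (fun w : List ℕ => w.length = n) x (fun w => X w ω) hw).symm

theorem integral_condMean {n : ℕ} {f : S → ℝ} (hf : Measurable f) {C : ℝ}
    (hC : ∀ x, |f x| ≤ C) :
    ∫ y, R.condMean n f y ∂(Measure.infinitePi fun _ : List ℕ => (μ : Measure S)) =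
      ∫ x, f x ∂(μ : Measure S) := by
  rw [← hX.integral_level [] (R.measurable_condMean n hf) fun y y' h => R.condMean_congr f h]
  have := integral_congr_ae (hX.condExp_root_eq (n := n) hf hC)
  rw [integral_condExp (sigmaFrom_le hX.measurable_X n)] at this
  simp only [List.nil_append]
  rw [← this, ← hX.X_law [], integral_map (hX.measurable_X _).aemeasurable hf.aestronglyMeasurable]

end IsInvariantRTP

end RTP

theorem abs_indicator_one_le {S : Type*} (A : Set S) (x : S) : |A.indicator (fun _ => (1 : ℝ)) x| ≤ 1 := by
  by_cases h : x ∈ A <;> simp [h]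

theorem abs_mul_sub_mul_le {a b c d : ℝ} (hb : |b| ≤ 1) (hc : |c| ≤ 1) :
    |a * b - c * d| ≤ |a - c| + |b - d| := by
  have : a * b - c * d = (a - c) * b + c * (b - d) := by ring
  rw [this]
  refine (abs_add_le _ _).trans ?_
  rw [abs_mul, abs_mul]
  exact add_le_add (mul_le_of_le_one_right (abs_nonneg _) hb)
    (mul_le_of_le_one_left (abs_nonneg _) hc)

theorem abs_prod_sub_prod_le {ι : Type*} (I : Finset ι) {a b : ι → ℝ} (ha : ∀ i, |a i| ≤ 1)
    (hb : ∀ i, |b i| ≤ 1) : |∏ i ∈ I, a i - ∏ i ∈ I, b i| ≤ ∑ i ∈ I, |a i - b i| := by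
  classical
  induction I using Finset.induction_on with
  | empty => simp
  | insert i I hi ih =>
    rw [Finset.prod_insert hi, Finset.prod_insert hi, Finset.sum_insert hi]
    refine (abs_mul_sub_mul_le ?_ (hb i)).trans (by gcongr)
    rw [Finset.abs_prod]
    exact Finset.prod_le_one (fun _ _ => abs_nonneg _) fun i _ => ha i

theorem abs_integral_mul_sub_le {Ω : Type*} {mΩ : MeasurableSpace Ω} {P : Measure Ω}
    [IsProbabilityMeasure P] {a b c d : Ω → ℝ} (ha : AEStronglyMeasurable a P)
    (hb : AEStronglyMeasurable b P) (hc : AEStronglyMeasurable c P)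
    (hd : AEStronglyMeasurable d P) (ha1 : ∀ᵐ ω ∂P, |a ω| ≤ 1) (hb1 : ∀ᵐ ω ∂P, |b ω| ≤ 1)
    (hc1 : ∀ᵐ ω ∂P, |c ω| ≤ 1) (hd1 : ∀ᵐ ω ∂P, |d ω| ≤ 1) :
    |∫ ω, a ω * b ω ∂P - ∫ ω, c ω * d ω ∂P| ≤
      ∫ ω, |a ω - c ω| ∂P + ∫ ω, |b ω - d ω| ∂P := by
  have hia : Integrable a P := Integrable.of_bound ha 1 ha1
  have hib : Integrable b P := Integrable.of_bound hb 1 hb1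
  have hic : Integrable c P := Integrable.of_bound hc 1 hc1
  have hid : Integrable d P := Integrable.of_bound hd 1 hd1
  have hab : Integrable (fun ω => a ω * b ω) P := hia.mul_bdd hb hb1
  have hcd : Integrable (fun ω => c ω * d ω) P := hic.mul_bdd hd hd1
  have hac : Integrable (fun ω => |a ω - c ω|) P := (hia.sub hic).abs
  have hbd : Integrable (fun ω => |b ω - d ω|) P := (hib.sub hid).abs
  rw [← integral_sub hab hcd, ← integral_add hac hbd]
  refine abs_integral_le_integral_abs.trans (integral_mono_ae (hab.sub hcd).abs
    (hac.add hbd) ?_)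
  filter_upwards [hb1, hc1] with ω h1 h2
  exact abs_mul_sub_mul_le h1 h2

/-! ### Couplings with given marginals, and the mixing property. -/

section Marginals

variable {S : Type*} [MeasurableSpace S]

theorem measurable_indicator_one {A : Set S} (hA : MeasurableSet A) :
    Measurable (A.indicator fun _ => (1 : ℝ)) := measurable_const.indicator hA

theorem integral_indicator_mul_indicator (q : Measure (S × S)) {A B : Set S}
    (hA : MeasurableSet A) (hB : MeasurableSet B) :
    ∫ p, A.indicator (fun _ => (1 : ℝ)) p.1 * B.indicator (fun _ => (1 : ℝ)) p.2 ∂q =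
      q.real (A ×ˢ B) := by
  rw [← integral_indicator_one (hA.prod hB)]
  refine integral_congr_ae (ae_of_all _ fun p => ?_)
  by_cases h1 : p.1 ∈ A <;> by_cases h2 : p.2 ∈ B <;> simp [h1, h2]

theorem mem_withMarginals_of_real {μ : ProbabilityMeasure S} {lam : ProbabilityMeasure (S × S)}
    (h1 : ∀ A, MeasurableSet A →
      (lam : Measure (S × S)).real (A ×ˢ Set.univ) = (μ : Measure S).real A)
    (h2 : ∀ A, MeasurableSet A →
      (lam : Measure (S × S)).real (Set.univ ×ˢ A) = (μ : Measure S).real A) :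
    lam ∈ withMarginals μ := by
  constructor
  · apply Subtype.ext
    refine Measure.ext fun A hA => ?_
    change (lam : Measure (S × S)).map Prod.fst A = (μ : Measure S) A
    rw [Measure.map_apply measurable_fst hA, ← Set.prod_univ]
    exact (measureReal_eq_measureReal_iff (measure_ne_top _ _) (measure_ne_top _ _)).1 (h1 A hA)
  · apply Subtype.ext
    refine Measure.ext fun A hA => ?_
    change (lam : Measure (S × S)).map Prod.snd A = (μ : Measure S) A
    rw [Measure.map_apply measurable_snd hA, ← Set.univ_prod]
    exact (measureReal_eq_measureReal_iff (measure_ne_top _ _) (measure_ne_top _ _)).1 (h2 A hA)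

theorem map_fst_of_mem_withMarginals {μ : ProbabilityMeasure S}
    {lam : ProbabilityMeasure (S × S)} (h : lam ∈ withMarginals μ) :
    (lam : Measure (S × S)).map Prod.fst = μ := congrArg Subtype.val h.1

theorem map_snd_of_mem_withMarginals {μ : ProbabilityMeasure S}
    {lam : ProbabilityMeasure (S × S)} (h : lam ∈ withMarginals μ) :
    (lam : Measure (S × S)).map Prod.snd = μ := congrArg Subtype.val h.2

theorem diagonal_toMeasure (μ : ProbabilityMeasure S) :
    (diagonal μ : Measure (S × S)) = (μ : Measure S).map fun x => (x, x) := rfl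

theorem prod_mem_withMarginals (μ : ProbabilityMeasure S) : μ.prod μ ∈ withMarginals μ := by
  constructor <;> apply Subtype.ext
  · change ((μ : Measure S).prod (μ : Measure S)).map Prod.fst = _
    rw [Measure.map_fst_prod]; simp
  · change ((μ : Measure S).prod (μ : Measure S)).map Prod.snd = _
    rw [Measure.map_snd_prod]; simp

theorem diagonal_mem_withMarginals (μ : ProbabilityMeasure S) :
    diagonal μ ∈ withMarginals μ := by
  constructor <;> apply Subtype.ext
  · change ((μ : Measure S).map fun x => (x, x)).map Prod.fst = _
    rw [Measure.map_map measurable_fst (by fun_prop)]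
    exact Measure.map_id
  · change ((μ : Measure S).map fun x => (x, x)).map Prod.snd = _
    rw [Measure.map_map measurable_snd (by fun_prop)]
    exact Measure.map_id

theorem integral_fst_field {μ : ProbabilityMeasure S} {lam : ProbabilityMeasure (S × S)}
    (h : lam ∈ withMarginals μ) {F : (List ℕ → S) → ℝ} (hF : Measurable F) :
    ∫ z, F (fun i => (z i).1) ∂(Measure.infinitePi fun _ : List ℕ => (lam : Measure (S × S))) =
      ∫ y, F y ∂(Measure.infinitePi fun _ : List ℕ => (μ : Measure S)) := by
  rw [← map_fst_of_mem_withMarginals h, ← Measure.infinitePi_map_pi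
    (fun _ : List ℕ => (lam : Measure (S × S))) (fun _ => measurable_fst),
    integral_map (Measurable.aemeasurable (by fun_prop)) hF.aestronglyMeasurable]

theorem integral_snd_field {μ : ProbabilityMeasure S} {lam : ProbabilityMeasure (S × S)}
    (h : lam ∈ withMarginals μ) {F : (List ℕ → S) → ℝ} (hF : Measurable F) :
    ∫ z, F (fun i => (z i).2) ∂(Measure.infinitePi fun _ : List ℕ => (lam : Measure (S × S))) =
      ∫ y, F y ∂(Measure.infinitePi fun _ : List ℕ => (μ : Measure S)) := by
  rw [← map_snd_of_mem_withMarginals h, ← Measure.infinitePi_map_pi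
    (fun _ : List ℕ => (lam : Measure (S × S))) (fun _ => measurable_snd),
    integral_map (Measurable.aemeasurable (by fun_prop)) hF.aestronglyMeasurable]

variable {E : Type*} [MeasurableSpace E]

theorem RDE.integral_biOp_iterate_diagonal (R : RDE E S) (μ : ProbabilityMeasure S) (n : ℕ)
    {f g : S → ℝ} (hf : Measurable f) (hg : Measurable g) {C D : ℝ} (hC : ∀ x, |f x| ≤ C)
    (hD : ∀ x, |g x| ≤ D) :
    ∫ p, f p.1 * g p.2 ∂(R.biOp^[n] (diagonal μ) : Measure (S × S)) =
      ∫ y, R.condMean n f y * R.condMean n g y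
        ∂(Measure.infinitePi fun _ : List ℕ => (μ : Measure S)) := by
  rw [R.integral_biOp_iterate _ n hf hg hC hD, diagonal_toMeasure,
    ← Measure.infinitePi_map_pi (fun _ : List ℕ => (μ : Measure S))
      (f := fun _ x => (x, x)) (fun _ => by fun_prop),
    integral_map (Measurable.aemeasurable (by fun_prop))]
  exact (((R.measurable_condMean n hf).comp (by fun_prop)).mul
    ((R.measurable_condMean n hg).comp (by fun_prop))).aestronglyMeasurable

/-- The conditional means of bounded functions of the root given generation `n` converge to
constants in `L¹`. -/
def RDE.IsMixing (R : RDE E S) (μ : ProbabilityMeasure S) : Prop :=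
  ∀ (f : S → ℝ) (C : ℝ), Measurable f → (∀ x, |f x| ≤ C) →
    Tendsto (fun n => ∫ y, |R.condMean n f y - ∫ x, f x ∂(μ : Measure S)|
      ∂(Measure.infinitePi fun _ : List ℕ => (μ : Measure S))) atTop (𝓝 0)

end Marginals

namespace RDE.IsMixing

variable {E S : Type*} [MeasurableSpace E] [TopologicalSpace S] [PolishSpace S]
  [MeasurableSpace S] [BorelSpace S] {R : RDE E S} {μ : ProbabilityMeasure S}

/-- Each coordinate of the boundary field is i.i.d. with law `μ`, so each conditional mean tends to
a constant in `L¹`. The coupling between coordinates then plays no role in the limit of the product.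
-/
theorem tendsto_biOp_iterate (h : R.IsMixing μ) {lam : ProbabilityMeasure (S × S)}
    (hlam : lam ∈ withMarginals μ) :
    Tendsto (fun n => R.biOp^[n] lam) atTop (𝓝 (μ.prod μ)) := by
  refine tendsto_of_tendsto_rectangles fun A B hA hB => ?_
  set f := A.indicator fun _ => (1 : ℝ)
  set g := B.indicator fun _ => (1 : ℝ)
  have hf := measurable_indicator_one hA
  have hg := measurable_indicator_one hB
  have hprod : ((μ.prod μ : ProbabilityMeasure (S × S)) : Measure (S × S)).real (A ×ˢ B) =
      (∫ x, f x ∂(μ : Measure S)) * ∫ x, g x ∂(μ : Measure S) := by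
    change ((μ : Measure S).prod (μ : Measure S)).real (A ×ˢ B) = _
    rw [measureReal_prod_prod]
    congr 1
    · exact (integral_indicator_one hA).symm
    · exact (integral_indicator_one hB).symm
  have hc : |∫ x, f x ∂(μ : Measure S)| ≤ 1 := by
    have := norm_integral_le_of_norm_le_const (μ := (μ : Measure S)) (f := f) (C := 1)
      (ae_of_all _ fun x => abs_indicator_one_le A x)
    simpa using this
  have hlim := (h f 1 hf (abs_indicator_one_le A)).add (h g 1 hg (abs_indicator_one_le B))
  rw [add_zero] at hlim
  rw [tendsto_iff_norm_sub_tendsto_zero]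
  refine squeeze_zero (fun n => norm_nonneg _) (fun n => ?_) hlim
  have hmf : Measurable fun y => |R.condMean n f y - ∫ x, f x ∂(μ : Measure S)| :=
    ((R.measurable_condMean n hf).sub_const _).abs
  have hmg : Measurable fun y => |R.condMean n g y - ∫ x, g x ∂(μ : Measure S)| :=
    ((R.measurable_condMean n hg).sub_const _).abs
  have hcf : Measurable fun z : List ℕ → S × S => R.condMean n f fun i => (z i).1 :=
    (R.measurable_condMean n hf).comp (by fun_prop)
  have hcg : Measurable fun z : List ℕ → S × S => R.condMean n g fun i => (z i).2 :=
    (R.measurable_condMean n hg).comp (by fun_prop)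
  have hbf : ∀ y, |R.condMean n f y| ≤ 1 := R.abs_condMean_le n (abs_indicator_one_le A)
  have hbg : ∀ y, |R.condMean n g y| ≤ 1 := R.abs_condMean_le n (abs_indicator_one_le B)
  have hd : |∫ x, g x ∂(μ : Measure S)| ≤ 1 := by
    have := norm_integral_le_of_norm_le_const (μ := (μ : Measure S)) (f := g) (C := 1)
      (ae_of_all _ fun x => abs_indicator_one_le B x)
    simpa using this
  have key := abs_integral_mul_sub_le
    (P := Measure.infinitePi fun _ : List ℕ => (lam : Measure (S × S)))
    (c := fun _ => ∫ x, f x ∂(μ : Measure S)) (d := fun _ => ∫ x, g x ∂(μ : Measure S))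
    hcf.aestronglyMeasurable hcg.aestronglyMeasurable aestronglyMeasurable_const
    aestronglyMeasurable_const (ae_of_all _ fun _ => hbf _) (ae_of_all _ fun _ => hbg _)
    (ae_of_all _ fun _ => hc) (ae_of_all _ fun _ => hd)
  rw [hprod, ← integral_indicator_mul_indicator _ hA hB, R.integral_biOp_iterate lam n hf hg
    (abs_indicator_one_le A) (abs_indicator_one_le B), ← integral_fst_field hlam hmf,
    ← integral_snd_field hlam hmg, Real.norm_eq_abs]
  simpa using key

end RDE.IsMixing

/-! ### Mixing and triviality of the tail. -/

section Trivial

theorem condExp_ae_eq_const {Ω : Type*} {m mΩ : MeasurableSpace Ω} {P : Measure Ω}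
    [IsProbabilityMeasure P] (hm : m ≤ mΩ) (htriv : ∀ A, MeasurableSet[m] A → P A = 0 ∨ P A = 1)
    {f : Ω → ℝ} (hf : Integrable f P) : P[f | m] =ᵐ[P] fun _ => ∫ ω, f ω ∂P := by
  refine (ae_eq_condExp_of_forall_setIntegral_eq hm hf
    (fun _ _ _ => (integrable_const _).integrableOn) (fun A hA _ => ?_)
    aestronglyMeasurable_const).symm
  rcases htriv A hA with h | h
  · rw [Measure.restrict_eq_zero.2 h]; simp
  · have h0 : P Aᶜ = 0 := by rw [measure_compl (hm A hA) (measure_ne_top _ _), h]; simp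
    rw [setIntegral_const, measureReal_def, h, Measure.restrict_eq_self_of_ae_mem
      (mem_ae_iff.2 h0)]
    simp

variable {E S Ω : Type*} [MeasurableSpace E] [MeasurableSpace S] {mΩ : MeasurableSpace Ω}
  {P : Measure Ω} [IsProbabilityMeasure P] {R : RDE E S} {μ : ProbabilityMeasure S}
  {innov : List ℕ → Ω → E × ℕ∞} {X : List ℕ → Ω → S}

theorem tailSigma_le (hX : ∀ i, Measurable (X i)) : tailSigma X ≤ mΩ :=
  (iInf_le _ 0).trans (sigmaFrom_le hX 0)

namespace IsInvariantRTP

variable (hX : IsInvariantRTP R μ P innov X)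

include hX

theorem integrable_root {f : S → ℝ} (hf : Measurable f) {C : ℝ} (hC : ∀ x, |f x| ≤ C) :
    Integrable (fun ω => f (X [] ω)) P :=
  Integrable.of_bound (hf.comp (hX.measurable_X _)).aestronglyMeasurable C
    (ae_of_all _ fun _ => hC _)

theorem tendsto_condExp_root {f : S → ℝ} (hf : Measurable f) {C : ℝ} (hC : ∀ x, |f x| ≤ C) :
    Tendsto (fun n => ∫ ω, |R.condMean n f (fun w => X w ω) -
      P[fun ω => f (X [] ω) | tailSigma X] ω| ∂P) atTop (𝓝 0) := by
  have h := tendsto_integral_abs_condExp_sub (P := P) (sigmaFrom_antitone X)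
    (sigmaFrom_le hX.measurable_X) (f := fun ω => f (X [] ω))
    (MemLp.of_bound (hf.comp (hX.measurable_X _)).aestronglyMeasurable C (ae_of_all _ fun _ => hC _))
  refine h.congr fun n => integral_congr_ae ?_
  filter_upwards [hX.condExp_root_eq (n := n) hf hC] with ω hω
  rw [hω]

theorem isMixing_of_trivialTail (h : TrivialTail P X) : R.IsMixing μ := by
  intro f C hf hC
  refine (hX.tendsto_condExp_root hf hC).congr fun n => ?_
  have h1 := condExp_ae_eq_const (tailSigma_le hX.measurable_X) h (hX.integrable_root hf hC)
  have h2 := hX.integral_level (n := n) []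
    (F := fun y => |R.condMean n f y - ∫ x, f x ∂(μ : Measure S)|)
    ((R.measurable_condMean n hf).sub_const _).abs
    (fun y y' hy => by rw [R.condMean_congr f hy])
  have h3 : ∫ x, f x ∂(μ : Measure S) = ∫ ω, f (X [] ω) ∂P := by
    rw [← hX.X_law [], integral_map (hX.measurable_X _).aemeasurable hf.aestronglyMeasurable]
  rw [← h2]
  refine integral_congr_ae ?_
  filter_upwards [h1] with ω hω
  rw [hω, h3]
  rfl

/-- Conditioning on generation `d + k` replaces the indicators by conditional means at the vertices
of `I`, and mixing sends these to the constants `μ (A i)` as `k → ∞`. -/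
theorem setIntegral_prod_indicator_eq (h : R.IsMixing μ) {d : ℕ} {I : Finset (List ℕ)}
    (hI : ∀ i ∈ I, i.length = d) {A : List ℕ → Set S} (hA : ∀ i, MeasurableSet (A i)) {B : Set Ω}
    (hB : MeasurableSet[tailSigma X] B) :
    P.real (B ∩ ⋂ i ∈ I, X i ⁻¹' A i) = P.real B * ∏ i ∈ I, (μ : Measure S).real (A i) := by
  let f : List ℕ → S → ℝ := fun i => (A i).indicator fun _ => (1 : ℝ)
  have hf : ∀ i, Measurable (f i) := fun i => measurable_indicator_one (hA i)
  have hf1 : ∀ i x, |f i x| ≤ 1 := fun i x => abs_indicator_one_le (A i) x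
  have hBm : MeasurableSet B := tailSigma_le hX.measurable_X B hB
  have hXm : ∀ i : List ℕ, Measurable fun ω w => X (i ++ w) ω := fun i =>
    measurable_pi_lambda _ fun w => hX.measurable_X _
  have hinter : MeasurableSet (⋂ i ∈ I, X i ⁻¹' A i) :=
    Finset.measurableSet_biInter _ fun i _ => hX.measurable_X i (hA i)
  have h1 : P.real (B ∩ ⋂ i ∈ I, X i ⁻¹' A i) = ∫ ω in B, ∏ i ∈ I, f i (X i ω) ∂P := by
    rw [Set.inter_comm, ← measureReal_restrict_apply hinter, ← integral_indicator_one hinter]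
    refine integral_congr_ae (ae_of_all _ fun ω => ?_)
    by_cases hω : ∀ i ∈ I, X i ω ∈ A i
    · rw [Set.indicator_of_mem (by simpa using hω)]
      exact (Finset.prod_eq_one fun i hi => Set.indicator_of_mem (hω i hi) _).symm
    · rw [Set.indicator_of_notMem (by simpa using hω)]
      push Not at hω
      obtain ⟨i, hi, hiA⟩ := hω
      exact (Finset.prod_eq_zero hi (Set.indicator_of_notMem hiA _)).symm
  have hc : ∀ i, ∫ x, f i x ∂(μ : Measure S) = (μ : Measure S).real (A i) := fun i =>
    integral_indicator_one (hA i)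
  have h2 : Tendsto (fun k => ∫ ω in B, ∏ i ∈ I, R.condMean k (f i) (fun w => X (i ++ w) ω) ∂P)
      atTop (𝓝 (P.real B * ∏ i ∈ I, (μ : Measure S).real (A i))) := by
    have hlim : Tendsto (fun k => ∑ i ∈ I, ∫ y, |R.condMean k (f i) y -
        ∫ x, f i x ∂(μ : Measure S)| ∂(Measure.infinitePi fun _ : List ℕ => (μ : Measure S)))
        atTop (𝓝 0) := by
      have := tendsto_finsetSum I fun i _ => h (f i) 1 (hf i) (hf1 i)
      simpa using this
    rw [tendsto_iff_norm_sub_tendsto_zero]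
    refine squeeze_zero (fun _ => norm_nonneg _) (fun k => ?_) hlim
    have hm : ∀ i, Measurable fun ω => R.condMean k (f i) fun w => X (i ++ w) ω := fun i =>
      (R.measurable_condMean k (hf i)).comp (hXm i)
    have hb : ∀ i y, |R.condMean k (f i) y| ≤ 1 := fun i y => R.abs_condMean_le k (hf1 i) y
    have hint : Integrable (fun ω => ∏ i ∈ I, R.condMean k (f i) fun w => X (i ++ w) ω) P := by
      refine Integrable.of_bound
        (Finset.measurable_fun_prod _ fun i _ => hm i).aestronglyMeasurable 1 (ae_of_all _ fun ω => ?_)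
      rw [Real.norm_eq_abs, Finset.abs_prod]
      exact Finset.prod_le_one (fun _ _ => abs_nonneg _) fun i _ => hb i _
    have hdiff : ∀ i, Integrable (fun ω => |R.condMean k (f i) (fun w => X (i ++ w) ω) -
        (μ : Measure S).real (A i)|) P := fun i =>
      ((Integrable.of_bound (hm i).aestronglyMeasurable 1 (ae_of_all _ fun _ => hb i _)).sub
        (integrable_const _)).abs
    have e1 : P.real B * ∏ i ∈ I, (μ : Measure S).real (A i) =
        ∫ ω in B, ∏ i ∈ I, (μ : Measure S).real (A i) ∂P := by
      rw [setIntegral_const, smul_eq_mul]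
    have e2 : ∀ i, ∫ y, |R.condMean k (f i) y - ∫ x, f i x ∂(μ : Measure S)|
        ∂(Measure.infinitePi fun _ : List ℕ => (μ : Measure S)) =
        ∫ ω, |R.condMean k (f i) (fun w => X (i ++ w) ω) - (μ : Measure S).real (A i)| ∂P := by
      intro i
      rw [hc i, ← hX.integral_level (n := k) i
        (F := fun y => |R.condMean k (f i) y - (μ : Measure S).real (A i)|)
        ((R.measurable_condMean k (hf i)).sub_const _).abs
        (fun y y' hy => by rw [R.condMean_congr (f i) hy])]
    simp only [e2]
    rw [e1, ← integral_sub hint.integrableOn (integrable_const _),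
      ← integral_finsetSum _ fun i _ => hdiff i]
    have hdiffI := hint.sub (integrable_const (∏ i ∈ I, (μ : Measure S).real (A i)))
    refine (norm_integral_le_integral_norm _).trans
      ((setIntegral_le_integral hdiffI.norm (ae_of_all _ fun _ => norm_nonneg _)).trans
      (integral_mono hdiffI.norm (integrable_finsetSum _ fun i _ => hdiff i) fun ω => ?_))
    exact abs_prod_sub_prod_le I (fun i => hb i _) fun i => by
      rw [abs_of_nonneg measureReal_nonneg]; exact measureReal_le_one
  rw [h1]
  refine tendsto_nhds_unique ?_ h2
  -- A tail event lies in `sigmaFrom X (d + k)` for every `k`, so the integral of the conditional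
  -- means does not depend on `k`.
  refine tendsto_const_nhds.congr fun k => ?_
  exact hX.setIntegral_prod_eq hI hf hf1 (iInf_le (sigmaFrom X) (d + k) B hB)

theorem indep_generation_tailSigma (h : R.IsMixing μ) (d : ℕ) :
    Indep (⨆ i ∈ {i : List ℕ | i.length = d}, MeasurableSpace.comap (X i) inferInstance)
      (tailSigma X) P := by
  have hle := tailSigma_le hX.measurable_X
  refine IndepSets.indep (p1 := piiUnionInter
      (fun i => {s | MeasurableSet[MeasurableSpace.comap (X i) inferInstance] s})
      {i : List ℕ | i.length = d}) (p2 := {s | MeasurableSet[tailSigma X] s})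
    (iSup₂_le fun i _ => (hX.measurable_X i).comap_le) hle
    (isPiSystem_piiUnionInter _ (fun i => @MeasurableSpace.isPiSystem_measurableSet _
      (MeasurableSpace.comap (X i) inferInstance)) _)
    (@MeasurableSpace.isPiSystem_measurableSet _ (tailSigma X))
    (generateFrom_piiUnionInter_measurableSet _ _).symm
    (@MeasurableSpace.generateFrom_measurableSet _ (tailSigma X)).symm ?_
  rw [IndepSets_iff]
  rintro s B ⟨I, hI, g, hg, rfl⟩ hB
  have hex : ∀ i, ∃ A : Set S, MeasurableSet A ∧ (i ∈ I → X i ⁻¹' A = g i) := by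
    intro i
    by_cases hi : i ∈ I
    · obtain ⟨A, hA, hAg⟩ := hg i hi
      exact ⟨A, hA, fun _ => hAg⟩
    · exact ⟨∅, MeasurableSet.empty, fun h => absurd h hi⟩
  choose A hA hAg using hex
  have hgA : (⋂ i ∈ I, g i) = ⋂ i ∈ I, X i ⁻¹' A i :=
    Set.iInter₂_congr fun i hi => (hAg i hi).symm
  have h1 := hX.setIntegral_prod_indicator_eq h (fun i hi => hI hi) hA hB
  have h2 := hX.setIntegral_prod_indicator_eq h (fun i hi => hI hi) hA
    (@MeasurableSet.univ _ (tailSigma X))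
  rw [Set.univ_inter, probReal_univ, one_mul] at h2
  rw [← h2, ← hgA, Set.inter_comm, mul_comm, measureReal_def, measureReal_def, measureReal_def,
    ← ENNReal.toReal_mul] at h1
  exact (ENNReal.toReal_eq_toReal_iff' (measure_ne_top _ _)
    (ENNReal.mul_ne_top (measure_ne_top _ _) (measure_ne_top _ _))).1 h1

/-- The innovations before generation `d` are independent of `sigmaFrom X d`, which contains both
generation `d` and the tail. Since generation `d` is independent of the tail, so is the pair of it
with these innovations, which determines all generations up to `d` almost surely. -/
theorem indep_upto_tailSigma (h : R.IsMixing μ) (d : ℕ) :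
    Indep (MeasurableSpace.comap
      (fun ω (i : {i : List ℕ // 0 ≤ i.length ∧ i.length ≤ d}) => X i ω) inferInstance)
      (tailSigma X) P := by
  have hle := tailSigma_le hX.measurable_X
  let U : Ω → {i : List ℕ // i.length < d} → E × ℕ∞ := fun ω i => innov i ω
  let V : Ω → {i : List ℕ // i.length = d} → S := fun ω i => X i ω
  have hU : Measurable U := measurable_pi_lambda _ fun i => hX.measurable_innov i
  have hV : Measurable V := measurable_pi_lambda _ fun i => hX.measurable_X i
  -- The tail enters as a random variable: the identity into `Ω` with the tail σ-algebra.
  have hid : Measurable[mΩ, tailSigma X] (id : Ω → Ω) := measurable_id'' hle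
  have h1 : @IndepFun _ _ _ mΩ inferInstance (@Prod.instMeasurableSpace _ _ _ (tailSigma X))
      U (fun ω => (V ω, id ω)) P := by
    refine indep_of_indep_of_le_right (hX.indep_innov_sigmaFrom d) ?_
    refine Measurable.comap_le ?_
    refine @Measurable.prodMk _ (sigmaFrom X d) _ _ _ (tailSigma X) _ _ ?_ ?_
    · exact @measurable_pi_lambda _ _ _ (sigmaFrom X d) _ _
        fun i => measurable_sigmaFrom X i.2.ge
    · exact measurable_id'' (iInf_le _ d)
  have h2 : @IndepFun _ _ _ mΩ inferInstance (tailSigma X) V id P := by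
    have h3 := hX.indep_generation_tailSigma h d
    change Indep (MeasurableSpace.comap V inferInstance)
      (MeasurableSpace.comap id (tailSigma X)) P
    rw [MeasurableSpace.comap_id, MeasurableSpace.comap_process_pi]
    simpa only [iSup_subtype, Set.mem_ofPred_eq] using h3
  have h3 := indepFun_prodMk_of_indepFun (mγ := tailSigma X) hU hV hid h1 h2
  obtain ⟨φ, hφ, hφX⟩ := hX.exists_measurable_range 0 d
  have hψ : Measurable fun p : ({i : List ℕ // i.length < d} → E × ℕ∞) ×
      ({i : List ℕ // i.length = d} → S) => φ (p.2, fun i => p.1 ⟨i, i.2.2⟩) :=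
    hφ.comp (measurable_snd.prodMk (measurable_pi_lambda _ fun i =>
      (measurable_pi_apply _).comp measurable_fst))
  have h4 := IndepFun.congr (h3.comp hψ (@measurable_id _ (tailSigma X))) hφX (ae_eq_refl _)
  change Indep _ (MeasurableSpace.comap id (tailSigma X)) P at h4
  rwa [MeasurableSpace.comap_id] at h4

/-- A zero-one law: the tail is independent of the σ-algebra generated by all generations, which
contains the tail. -/
theorem trivialTail_of_isMixing (h : R.IsMixing μ) : TrivialTail P X := by
  have hle := tailSigma_le hX.measurable_X
  let G : ℕ → MeasurableSpace Ω := fun d => MeasurableSpace.comap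
    (fun ω (i : {i : List ℕ // 0 ≤ i.length ∧ i.length ≤ d}) => X i ω) inferInstance
  have hG : ∀ d, G d = ⨆ (i : {i : List ℕ // 0 ≤ i.length ∧ i.length ≤ d}),
      MeasurableSpace.comap (X i) inferInstance := fun d => MeasurableSpace.comap_process_pi _
  have hmono : Monotone G := by
    intro a b hab
    simp only [hG]
    exact iSup_le fun i => le_iSup_of_le (⟨i.1, i.2.1, i.2.2.trans hab⟩ :
      {i : List ℕ // 0 ≤ i.length ∧ i.length ≤ b}) le_rfl
  have hGle : ∀ d, G d ≤ mΩ := fun d =>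
    Measurable.comap_le (measurable_pi_lambda _ fun i => hX.measurable_X i)
  have h1 := indep_iSup_of_monotone (fun d => hX.indep_upto_tailSigma h d) hGle hle hmono
  have h2 : tailSigma X ≤ ⨆ d, G d := by
    refine (iInf_le _ 0).trans (iSup₂_le fun i _ => le_iSup_of_le i.length ?_)
    refine le_of_le_of_eq ?_ (hG i.length).symm
    exact le_iSup_of_le (⟨i, Nat.zero_le _, le_rfl⟩ :
      {j : List ℕ // 0 ≤ j.length ∧ j.length ≤ i.length}) le_rfl
  have h3 := indep_of_indep_of_le_left h1 h2
  intro A hA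
  exact measure_eq_zero_or_one_of_indepSet_self (h3.indepSet_of_measurableSet hA hA)

/-- Lets mixing pass to `L¹` limits of `f`. The factor `2` counts the change of the conditional
mean, an `L¹` contraction, and that of the mean. -/
theorem integral_abs_condMean_sub_le (n : ℕ) {f g : S → ℝ} (hf : Measurable f)
    (hg : Measurable g) {C D : ℝ} (hC : ∀ x, |f x| ≤ C) (hD : ∀ x, |g x| ≤ D) :
    ∫ y, |R.condMean n f y - ∫ x, f x ∂(μ : Measure S)|
      ∂(Measure.infinitePi fun _ : List ℕ => (μ : Measure S)) ≤
    ∫ y, |R.condMean n g y - ∫ x, g x ∂(μ : Measure S)|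
      ∂(Measure.infinitePi fun _ : List ℕ => (μ : Measure S)) +
      2 * ∫ x, |f x - g x| ∂(μ : Measure S) := by
  set Q := Measure.infinitePi fun _ : List ℕ => (μ : Measure S)
  have hfg : Measurable fun x => |f x - g x| := (hf.sub hg).abs
  have hfgC : ∀ x, |(|f x - g x|)| ≤ C + D := fun x => by
    rw [abs_abs]; exact (abs_sub _ _).trans (add_le_add (hC x) (hD x))
  have hint : ∀ {u : S → ℝ} {B : ℝ}, Measurable u → (∀ x, |u x| ≤ B) →
      Integrable (R.condMean n u) Q := fun hu hB =>
    Integrable.of_bound (R.measurable_condMean n hu).aestronglyMeasurable _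
      (ae_of_all _ fun _ => R.abs_condMean_le n hB _)
  have hint' : ∀ {u : S → ℝ} {B : ℝ}, Measurable u → (∀ x, |u x| ≤ B) →
      Integrable u (μ : Measure S) := fun hu hB =>
    Integrable.of_bound hu.aestronglyMeasurable _ (ae_of_all _ fun _ => hB _)
  have hmean : |∫ x, f x ∂(μ : Measure S) - ∫ x, g x ∂(μ : Measure S)| ≤
      ∫ x, |f x - g x| ∂(μ : Measure S) := by
    rw [← integral_sub (hint' hf hC) (hint' hg hD)]
    exact abs_integral_le_integral_abs
  have hI : Integrable (fun y => |R.condMean n g y - ∫ x, g x ∂(μ : Measure S)|) Q :=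
    ((hint hg hD).sub (integrable_const _)).abs
  calc ∫ y, |R.condMean n f y - ∫ x, f x ∂(μ : Measure S)| ∂Q
      ≤ ∫ y, (|R.condMean n g y - ∫ x, g x ∂(μ : Measure S)| +
          (R.condMean n (fun x => |f x - g x|) y + ∫ x, |f x - g x| ∂(μ : Measure S))) ∂Q := by
        refine integral_mono ((hint hf hC).sub (integrable_const _)).abs
          (hI.add ((hint hfg hfgC).add (integrable_const _))) fun y => ?_
        have h1 := R.abs_condMean_le_condMean_abs n (fun x => f x - g x) y
        rw [← R.condMean_sub n hf hg hC hD] at h1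
        have h2 := abs_add_three (R.condMean n g y - ∫ x, g x ∂(μ : Measure S))
          (R.condMean n f y - R.condMean n g y)
          (∫ x, g x ∂(μ : Measure S) - ∫ x, f x ∂(μ : Measure S))
        rw [abs_sub_comm (∫ x, g x ∂(μ : Measure S))] at h2
        have h3 : R.condMean n f y - ∫ x, f x ∂(μ : Measure S) =
          (R.condMean n g y - ∫ x, g x ∂(μ : Measure S)) +
          (R.condMean n f y - R.condMean n g y) +
          (∫ x, g x ∂(μ : Measure S) - ∫ x, f x ∂(μ : Measure S)) := by ring
        simp only
        rw [h3]
        linarith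
    _ = _ := by
        have h4 : Integrable (fun y => R.condMean n (fun x => |f x - g x|) y +
          ∫ x, |f x - g x| ∂(μ : Measure S)) Q := (hint hfg hfgC).add (integrable_const _)
        rw [integral_add hI h4, integral_add (hint hfg hfgC) (integrable_const _),
          hX.integral_condMean hfg hfgC]
        simp
        ring

/-- With `n = 1` and the constant `1` in one coordinate, only a single conditional mean remains, and
its integral is that of `f` because `μ` is invariant. -/
theorem biOp_mem_withMarginals {lam : ProbabilityMeasure (S × S)} (h : lam ∈ withMarginals μ) :
    R.biOp lam ∈ withMarginals μ := by
  have hu := measurable_indicator_one (S := S) MeasurableSet.univ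
  have hone : ∀ y, R.condMean 1 (Set.univ.indicator fun _ => (1 : ℝ)) y = 1 := fun y => by
    rw [Set.indicator_univ]; exact R.condMean_const 1 1 y
  refine mem_withMarginals_of_real (fun A hA => ?_) fun A hA => ?_
  · have hA' := measurable_indicator_one hA
    rw [← integral_indicator_mul_indicator _ hA MeasurableSet.univ]
    refine (R.integral_biOp_iterate lam 1 hA' hu (abs_indicator_one_le A)
      (abs_indicator_one_le _)).trans ?_
    simp only [hone, mul_one]
    rw [integral_fst_field h (R.measurable_condMean 1 hA'),
      hX.integral_condMean hA' (abs_indicator_one_le A)]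
    exact integral_indicator_one hA
  · have hA' := measurable_indicator_one hA
    rw [← integral_indicator_mul_indicator _ MeasurableSet.univ hA]
    refine (R.integral_biOp_iterate lam 1 hu hA' (abs_indicator_one_le _)
      (abs_indicator_one_le A)).trans ?_
    simp only [hone, one_mul]
    rw [integral_snd_field h (R.measurable_condMean 1 hA'),
      hX.integral_condMean hA' (abs_indicator_one_le A)]
    exact integral_indicator_one hA

theorem biOp_prod : R.biOp (μ.prod μ) = μ.prod μ := by
  apply Subtype.ext
  refine (Measure.prod_eq (μν := (R.biOp (μ.prod μ) : Measure (S × S)))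
    fun A B hA hB => ?_).symm
  have hA' := measurable_indicator_one hA
  have hB' := measurable_indicator_one hB
  have h1 := R.integral_biOp_iterate (μ.prod μ) 1 hA' hB' (abs_indicator_one_le A)
    (abs_indicator_one_le B)
  rw [integral_indicator_mul_indicator _ hA hB] at h1
  have h2 : (Measure.infinitePi fun _ : List ℕ =>
      ((μ.prod μ : ProbabilityMeasure (S × S)) : Measure (S × S))) = _ :=
    (map_zip_infinitePi (ι := List ℕ) (μ : Measure S) (μ : Measure S)).symm
  have hm : Measurable fun (p : (List ℕ → S) × (List ℕ → S)) (i : List ℕ) => (p.1 i, p.2 i) := by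
    fun_prop
  rw [h2, integral_map hm.aemeasurable] at h1
  · rw [integral_prod_mul, hX.integral_condMean hA' (abs_indicator_one_le A),
      hX.integral_condMean hB' (abs_indicator_one_le B)] at h1
    have h3 := integral_indicator_one (μ := (μ : Measure S)) hA
    have h4 := integral_indicator_one (μ := (μ : Measure S)) hB
    have h5 : (R.biOp (μ.prod μ) : Measure (S × S)).real (A ×ˢ B) =
        (μ : Measure S).real A * (μ : Measure S).real B := h1.trans (congrArg₂ (· * ·) h3 h4)
    rw [measureReal_def, measureReal_def, measureReal_def, ← ENNReal.toReal_mul] at h5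
    exact (ENNReal.toReal_eq_toReal_iff' (measure_ne_top _ _)
      (ENNReal.mul_ne_top (measure_ne_top _ _) (measure_ne_top _ _))).1 h5
  · exact (((R.measurable_condMean 1 hA').comp (by fun_prop)).mul
      ((R.measurable_condMean 1 hB').comp (by fun_prop))).aestronglyMeasurable

end IsInvariantRTP

end Trivial

/-! ### Weak limits of the diagonal iterates. -/

section Polish

variable {E S Ω : Type*} [MeasurableSpace E] [TopologicalSpace S] [PolishSpace S]
  [MeasurableSpace S] [BorelSpace S] {mΩ : MeasurableSpace Ω}
  {P : Measure Ω} [IsProbabilityMeasure P] {R : RDE E S} {μ : ProbabilityMeasure S}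
  {innov : List ℕ → Ω → E × ℕ∞} {X : List ℕ → Ω → S}

namespace IsInvariantRTP

variable (hX : IsInvariantRTP R μ P innov X)

include hX

/-- Weak convergence tested on `g ⊗ g`, for `g` bounded continuous, makes the second moment of the
conditional mean converge to the square of its mean. Density of such `g` in `L¹(μ)` gives all
bounded measurable `f`. -/
theorem isMixing_of_tendsto_diagonal
    (h : Tendsto (fun n : ℕ => R.biOp^[n] (diagonal μ)) atTop (𝓝 (μ.prod μ))) :
    R.IsMixing μ := by
  set Q := Measure.infinitePi fun _ : List ℕ => (μ : Measure S) with hQ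
  have hcont : ∀ g : BoundedContinuousFunction S ℝ,
      Tendsto (fun n => ∫ y, |R.condMean n g y - ∫ x, g x ∂(μ : Measure S)| ∂Q) atTop (𝓝 0) := by
    intro g
    have hg : Measurable g := g.continuous.measurable
    have hgC : ∀ x, |g x| ≤ ‖g‖ := fun x => g.norm_coe_le_norm x
    set c := ∫ x, g x ∂(μ : Measure S)
    let G : BoundedContinuousFunction (S × S) ℝ :=
      g.compContinuous ⟨Prod.fst, continuous_fst⟩ * g.compContinuous ⟨Prod.snd, continuous_snd⟩
    have h1 := (ProbabilityMeasure.tendsto_iff_forall_integral_tendsto.1 h) G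
    have h2 : ∀ n, ∫ p, G p ∂(R.biOp^[n] (diagonal μ) : Measure (S × S)) =
        ∫ y, R.condMean n g y * R.condMean n g y ∂Q := fun n =>
      R.integral_biOp_iterate_diagonal μ n hg hg hgC hgC
    have h3 : ∫ p, G p ∂((μ.prod μ : ProbabilityMeasure (S × S)) : Measure (S × S)) = c * c :=
      integral_prod_mul (μ := (μ : Measure S)) (ν := (μ : Measure S)) g g
    simp only [h2, h3] at h1
    have hm : ∀ n, Measurable (R.condMean n g) := fun n => R.measurable_condMean n hg
    have hb : ∀ n y, |R.condMean n g y| ≤ ‖g‖ := fun n y => R.abs_condMean_le n hgC y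
    have hi : ∀ n, Integrable (R.condMean n g) Q := fun n =>
      Integrable.of_bound (hm n).aestronglyMeasurable _ (ae_of_all _ fun _ => hb n _)
    have h4 : ∀ n, ∫ y, (R.condMean n g y - c) ^ 2 ∂Q =
        ∫ y, R.condMean n g y * R.condMean n g y ∂Q - c * c := by
      intro n
      have hsq : Integrable (fun y => R.condMean n g y * R.condMean n g y) Q :=
        (hi n).mul_bdd (hm n).aestronglyMeasurable (ae_of_all _ fun _ => hb n _)
      have hmean : ∫ y, R.condMean n g y ∂Q = c := hX.integral_condMean hg hgC
      have e : ∀ y, (R.condMean n g y - c) ^ 2 =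
          R.condMean n g y * R.condMean n g y - (2 * c * R.condMean n g y - c * c) := fun y => by
        ring
      have hlin : Integrable (fun y => 2 * c * R.condMean n g y) Q := (hi n).const_mul _
      have hlin' : Integrable (fun y => 2 * c * R.condMean n g y - c * c) Q :=
        hlin.sub (integrable_const _)
      simp only [e]
      rw [integral_sub hsq hlin', integral_sub hlin (integrable_const _), integral_const_mul, hmean]
      simp
      ring
    have h5 : Tendsto (fun n => Real.sqrt (∫ y, (R.condMean n g y - c) ^ 2 ∂Q)) atTop (𝓝 0) := by
      have h6 : Tendsto (fun n => ∫ y, (R.condMean n g y - c) ^ 2 ∂Q) atTop (𝓝 0) := by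
        simp only [h4]
        simpa using h1.sub_const (c * c)
      simpa [Function.comp_def] using (Real.continuous_sqrt.tendsto 0).comp h6
    refine squeeze_zero (fun _ => integral_nonneg fun _ => abs_nonneg _) (fun n => ?_) h5
    apply Real.le_sqrt_of_sq_le
    have hmem : MemLp (fun y => |R.condMean n g y - c|) 2 Q :=
      MemLp.of_bound ((hm n).sub_const c).abs.aestronglyMeasurable (‖g‖ + |c|)
        (ae_of_all _ fun y => by
          rw [Real.norm_eq_abs, abs_abs]
          exact (abs_sub _ _).trans (by gcongr; exact hb n y))
    -- The `L¹` norm is bounded by the `L²` norm because the variance of the absolute deviation is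
    -- nonnegative.
    have hvar := variance_nonneg (fun y => |R.condMean n g y - c|) Q
    rw [variance_eq_sub hmem] at hvar
    simp only [Pi.pow_apply, sq_abs] at hvar
    linarith
  intro f C hf hC
  rw [Metric.tendsto_atTop]
  intro ε hε
  let := TopologicalSpace.upgradeIsCompletelyMetrizable S
  have hfi : Integrable f (μ : Measure S) :=
    Integrable.of_bound hf.aestronglyMeasurable C (ae_of_all _ hC)
  -- The final bound is `ε / 4 + 2 * (ε / 4) < ε`.
  obtain ⟨g, hg, -⟩ := hfi.exists_boundedContinuous_integral_sub_le (ε := ε / 4) (by positivity)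
  obtain ⟨N, hN⟩ := (Metric.tendsto_atTop.1 (hcont g)) (ε / 4) (by positivity)
  refine ⟨N, fun n hn => ?_⟩
  have h1 := hN n hn
  have h2 := hX.integral_abs_condMean_sub_le n hf g.continuous.measurable hC
    (fun x => g.norm_coe_le_norm x)
  simp only [Real.norm_eq_abs] at hg
  rw [Real.dist_0_eq_abs, abs_of_nonneg (integral_nonneg fun _ => abs_nonneg _)] at h1 ⊢
  linarith

/-- On `A ×ˢ B` the iterate is the expectation of the product of the conditional probabilities given
`sigmaFrom X n`. By reverse martingale convergence these tend to the ones given the tail, so the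
limit is the law of two conditionally independent copies of the root. -/
theorem exists_tendsto_diagonal : ∃ lam ∈ withMarginals μ,
    Tendsto (fun n : ℕ => R.biOp^[n] (diagonal μ)) atTop (𝓝 lam) := by
  have hle := tailSigma_le hX.measurable_X
  obtain ⟨lam, hlam⟩ := exists_conditionally_independent (P := P) hle (hX.measurable_X [])
  let M : Set S → Ω → ℝ := fun A =>
    P[fun ω => A.indicator (fun _ => (1 : ℝ)) (X [] ω) | tailSigma X]
  have hlam' : ∀ A B : Set S, MeasurableSet A → MeasurableSet B →
      (lam : Measure (S × S)).real (A ×ˢ B) = ∫ ω, M A ω * M B ω ∂P := hlam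
  have hM1 : ∀ A, ∀ᵐ ω ∂P, |M A ω| ≤ 1 := fun A =>
    ae_bdd_abs_condExp_of_ae_bdd_abs (R := (1 : ℝ)) (ae_of_all _ fun ω => abs_indicator_one_le A (X [] ω))
  have hMm : ∀ A, AEStronglyMeasurable (M A) P := fun A =>
    integrable_condExp.aestronglyMeasurable
  have hint : ∀ A, MeasurableSet A → ∫ ω, M A ω ∂P = (μ : Measure S).real A := by
    intro A hA
    have hA' := measurable_indicator_one hA
    rw [integral_condExp hle, ← integral_map (hX.measurable_X []).aemeasurable
      hA'.aestronglyMeasurable, hX.X_law]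
    exact integral_indicator_one hA
  have huniv : M Set.univ = fun _ => 1 := by
    simp only [M, Set.indicator_univ]
    exact condExp_const hle 1
  refine ⟨lam, mem_withMarginals_of_real (fun A hA => ?_) fun A hA => ?_,
    tendsto_of_tendsto_rectangles fun A B hA hB => ?_⟩
  · rw [hlam' A _ hA MeasurableSet.univ, huniv]
    simpa using hint A hA
  · rw [hlam' _ A MeasurableSet.univ hA, huniv]
    simpa using hint A hA
  · have hA' := measurable_indicator_one hA
    have hB' := measurable_indicator_one hB
    have hlim := (hX.tendsto_condExp_root hA' (abs_indicator_one_le A)).add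
      (hX.tendsto_condExp_root hB' (abs_indicator_one_le B))
    rw [add_zero] at hlim
    rw [tendsto_iff_norm_sub_tendsto_zero]
    refine squeeze_zero (fun _ => norm_nonneg _) (fun n => ?_) hlim
    have hXm : Measurable fun ω w => X w ω := measurable_pi_lambda _ hX.measurable_X
    have h1 := hX.integral_level (n := n) []
      (F := fun y => R.condMean n (A.indicator fun _ => (1 : ℝ)) y *
        R.condMean n (B.indicator fun _ => (1 : ℝ)) y)
      ((R.measurable_condMean n hA').mul (R.measurable_condMean n hB'))
      (fun y y' hy => by rw [R.condMean_congr _ hy, R.condMean_congr _ hy])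
    rw [← integral_indicator_mul_indicator _ hA hB, hlam' A B hA hB,
      R.integral_biOp_iterate_diagonal μ n hA' hB' (abs_indicator_one_le A)
        (abs_indicator_one_le B), ← h1]
    exact abs_integral_mul_sub_le
      ((R.measurable_condMean n hA').comp hXm).aestronglyMeasurable
      ((R.measurable_condMean n hB').comp hXm).aestronglyMeasurable (hMm A) (hMm B)
      (ae_of_all _ fun _ => R.abs_condMean_le n (abs_indicator_one_le A) _)
      (ae_of_all _ fun _ => R.abs_condMean_le n (abs_indicator_one_le B) _) (hM1 A) (hM1 B)

theorem tendsto_diagonal_of_bivariateUniqueness (hu : R.BivariateUniqueness μ)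
    (hc : ContinuousOn R.biOp (withMarginals μ)) :
    Tendsto (fun n : ℕ => R.biOp^[n] (diagonal μ)) atTop (𝓝 (μ.prod μ)) := by
  obtain ⟨lam, hlam, hlim⟩ := hX.exists_tendsto_diagonal
  have hmem : ∀ n, R.biOp^[n] (diagonal μ) ∈ withMarginals μ := by
    intro n
    induction n with
    | zero => exact diagonal_mem_withMarginals μ
    | succ n ih => rw [Function.iterate_succ_apply']; exact hX.biOp_mem_withMarginals ih
  have h1 : Tendsto (fun n : ℕ => R.biOp (R.biOp^[n] (diagonal μ))) atTop (𝓝 (R.biOp lam)) :=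
    (hc lam hlam).tendsto.comp
      (tendsto_nhdsWithin_iff.2 ⟨hlim, Eventually.of_forall hmem⟩)
  have h2 : Tendsto (fun n : ℕ => R.biOp (R.biOp^[n] (diagonal μ))) atTop (𝓝 lam) := by
    have := (tendsto_add_atTop_iff_nat 1).2 hlim
    simpa only [Function.iterate_succ_apply'] using this
  have h3 : lam ∈ {lam | lam ∈ withMarginals μ ∧ R.biOp lam = lam} :=
    ⟨hlam, tendsto_nhds_unique h1 h2⟩
  rw [hu] at h3
  rw [Set.mem_singleton_iff] at h3
  rwa [h3] at hlim

/-- The iterates of a fixed point are constant, yet mixing makes them converge to `μ ⊗ μ`. -/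
theorem bivariateUniqueness_of_isMixing (h : R.IsMixing μ) : R.BivariateUniqueness μ := by
  ext lam
  simp only [Set.mem_ofPred_eq, Set.mem_singleton_iff]
  constructor
  · rintro ⟨hlam, hfix⟩
    have h1 := h.tendsto_biOp_iterate hlam
    simp only [Function.iterate_fixed hfix] at h1
    exact tendsto_nhds_unique tendsto_const_nhds h1
  · rintro rfl
    exact ⟨prod_mem_withMarginals μ, hX.biOp_prod⟩

end IsInvariantRTP

end Polish

end RecTree

theorem theorem1 {E S Ω : Type*} [MeasurableSpace E]
    [TopologicalSpace S] [PolishSpace S] [MeasurableSpace S] [BorelSpace S]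
    [MeasurableSpace Ω] (P : Measure Ω) [IsProbabilityMeasure P]
    (R : RecTree.RDE E S) (μ : ProbabilityMeasure S)
    (innov : List ℕ → Ω → E × ℕ∞) (X : List ℕ → Ω → S)
    (hX : RecTree.IsInvariantRTP R μ P innov X) :
    (RecTree.TrivialTail P X → R.BivariateUniqueness μ) ∧
    (R.BivariateUniqueness μ → ContinuousOn R.biOp (RecTree.withMarginals μ) →
      RecTree.TrivialTail P X) ∧
    (RecTree.TrivialTail P X ↔
      Tendsto (fun n : ℕ => R.biOp^[n] (RecTree.diagonal μ)) atTop (𝓝 (μ.prod μ))) := by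
  refine ⟨fun h => hX.bivariateUniqueness_of_isMixing (hX.isMixing_of_trivialTail h),
    fun hu hc => hX.trivialTail_of_isMixing (hX.isMixing_of_tendsto_diagonal
      (hX.tendsto_diagonal_of_bivariateUniqueness hu hc)), fun h => ?_, fun h => ?_⟩
  · exact (hX.isMixing_of_trivialTail h).tendsto_biOp_iterate
      (RecTree.diagonal_mem_withMarginals μ)
  · exact hX.trivialTail_of_isMixing (hX.isMixing_of_tendsto_diagonal h)
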